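/- **Setting.** Let $\mathbf D$ be a finite algebra with at least two elements (in any signature of finitary operations) which has a bounded lattice reduct $\langle D,\wedge,\vee,0,1\rangle$ and is *semi-primal*: for every $n\ge 1$, every $f\colon D^n\to D$ which preserves all subalgebras of $\mathbf D$ is term-definable. So, for $d\in D$, the operation $T_d$ with $T_d(d)=1$ and $T_d(x)=0$ for $x\ne d$ is given by a unary term. Let $\mathbb S(\mathbf D)$ be the set of subalgebras of $\mathbf D$ ordered by inclusion, and let $\mathcal A$ be the variety generated by $\mathbf D$ (all algebras satisfying the equations valid in $\mathbf D$). *Categories and dual adjunctions.* Objects of $\mathsf{Set}_{\mathbf D}$ are pairs $(X,v)$ of a set $X$ and a map $v\colon X\to\mathbb S(\mathbf D)$; morphisms $(X_1,v_1)\to(X_2,v_2)$ are maps $f$ with $v_2(f(x))\le v_1(x)$ for all $x$. The contravariant functors $\mathsf P'(X,v)=\prod_{x\in X}v(x)$ and $\mathsf S'(\mathbf A)=(\mathcal A(\mathbf A,\mathbf D),\mathrm{im})$ form a dual adjunction between $\mathsf{Set}_{\mathbf D}$ and $\mathcal A$, whose units are evaluations. Similarly, the powerset functor $\mathsf P$ and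 the ultrafilter functor $\mathsf S$ form a dual adjunction between $\mathsf{Set}$ and the category $\mathsf{BA}$ of Boolean algebras. *Subalgebra functors.* For $\mathbf S\in\mathbb S(\mathbf D)$ let $\mathsf V^{\mathbf S}\colon\mathsf{Set}\to\mathsf{Set}_{\mathbf D}$ equip a set with the constant valuation $\mathbf S$, and let $\mathsf C^{\mathbf S}(X,v)=\{x\in X\mid v(x)\le\mathbf S\}$. Let $\mathfrak P_{\mathbf S}\colon\mathsf{BA}\to\mathcal A$ send $\mathbf B$ to the Boolean power $\mathbf S[\mathbf B]$, that is, the families $\xi\colon S\to B$ of pairwise disjoint elements with join $1$, with operations $o(\xi_1,\dots,\xi_n)(s)=\bigvee_{o(s_1,\dots,s_n)=s}\xi_1(s_1)\wedge\dots\wedge\xi_n(s_n)$. Let $\mathsf K_{\mathbf S}\colon\mathcal A\to\mathsf{BA}$ send $\mathbf A$ to $\mathfrak S(\mathbf A/\theta_{\mathbf S})$, where $a\mathrel{\theta_{\mathbf S}}b$ iff $u(a)=u(b)$ for all homomorphisms $u\colon\mathbf A\to\mathbf D$ with image in $\mathbf S$, and $\mathfrak S(\mathbf A)=\{a\mid T_1(a)=a\}$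 is the Boolean skeleton, with the lattice operations of $\mathbf A$ and complement $T_0$. *Logics and expressivity.* Let $\mathsf S\dashv\mathsf P$ be a dual adjunction between $\mathcal C$ and $\mathcal V$, with evaluation maps $\varepsilon\colon 1_{\mathcal C}\Rightarrow\mathsf{SP}$ and $\eta\colon 1_{\mathcal V}\Rightarrow\mathsf{PS}$. A coalgebraic logic for $\mathsf T\colon\mathcal C\to\mathcal C$ is a pair $(\mathsf L,\delta)$ of a functor $\mathsf L\colon\mathcal V\to\mathcal V$ and a natural transformation $\delta\colon\mathsf{LP}\Rightarrow\mathsf{PT}$. It is called classical for the adjunction between $\mathsf{Set}$ and $\mathsf{BA}$. The adjoint transpose is the composite $$\delta^\dagger\colon\ \mathsf{TS}\xrightarrow{\ \varepsilon\mathsf{TS}\ }\mathsf{SPTS}\xrightarrow{\ \mathsf S\delta\mathsf S\ }\mathsf{SLPS}\xrightarrow{\ \mathsf{SL}\eta\ }\mathsf{SL}.$$ Let $\mathcal M$ be a class of monomorphisms and $\mathcal E$ a class of epimorphisms of $\mathcal C$. The logic is *expressive* with respect to $(\mathcal M,\mathcal E)$ if (1) the category $\mathsf{Alg}(\mathsf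 L)$ of $\mathsf L$-algebras has an initial object, (2) every morphism of $\mathcal C$ factors as a member of $\mathcal E$ followed by a member of $\mathcal M$, (3) $\mathsf T$ preserves members of $\mathcal M$, and (4) every component of $\delta^\dagger$ is in $\mathcal M$. *Liftings.* The liftings of functors $\mathsf T\colon\mathsf{Set}\to\mathsf{Set}$ and $\mathsf L\colon\mathsf{BA}\to\mathsf{BA}$ are the functors $$\mathsf T'=\int^{\mathbf S\in\mathbb S(\mathbf D)}\mathsf V^{\mathbf S}\mathsf T\mathsf C^{\mathbf S}\colon\mathsf{Set}_{\mathbf D}\to\mathsf{Set}_{\mathbf D},\qquad \mathsf L'=\int_{\mathbf S\in\mathbb S(\mathbf D)}\mathfrak P_{\mathbf S}\mathsf L\mathsf K_{\mathbf S}\colon\mathcal A\to\mathcal A .$$ The lifting of a classical logic $(\mathsf L,\delta)$ for $\mathsf T$ is the logic $(\mathsf L',\delta')$ for $\mathsf T'$ in which $\delta'_{(X,v)}\colon\mathsf{L'P'}(X,v)\to\mathsf{P'T'}(X,v)\cong\int_{\mathbf S}\mathsf P'\mathsf V^{\mathbf S}\mathsf T\mathsf C^{\mathbf S}(X,v)$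 is induced by the wedge $$\mathsf{L'P'}(X,v)\to\mathfrak P_{\mathbf S}\mathsf L\mathsf K_{\mathbf S}\mathsf P'(X,v)\cong\mathfrak P_{\mathbf S}\mathsf{LP}\mathsf C^{\mathbf S}(X,v)\xrightarrow{\ \mathfrak P_{\mathbf S}\delta\ }\mathfrak P_{\mathbf S}\mathsf{PT}\mathsf C^{\mathbf S}(X,v)\cong\mathsf P'\mathsf V^{\mathbf S}\mathsf T\mathsf C^{\mathbf S}(X,v).$$ Here the first map is the projection of the end, the first isomorphism comes from $\mathsf K_{\mathbf S}\mathsf P'(X,v)\cong\mathsf P\mathsf C^{\mathbf S}(X,v)$, $[\alpha]\mapsto\{x\mid\alpha(x)=1\}$, and the second is inverse to $\alpha\mapsto(s\mapsto\{y\mid\alpha(y)=s\})$. **Theorem.** Let $(\mathsf L,\delta)$ be a classical coalgebraic logic for a functor $\mathsf T\colon\mathsf{Set}\to\mathsf{Set}$ such that $\mathsf L\colon\mathsf{BA}\to\mathsf{BA}$ and $\mathsf T$ preserve monomorphisms and epimorphisms. If $(\mathsf L,\delta)$ is expressive (with respect to some $(\mathcal M,\mathcal E)$ on $\mathsf{Set}$),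 then its lifting $(\mathsf L',\delta')$ is expressive with respect to the monomorphisms and the strong epimorphisms of $\mathsf{Set}_{\mathbf D}$. In particular, $\mathsf{Alg}(\mathsf L')$ has an initial object, every morphism of $\mathsf{Set}_{\mathbf D}$ factors as a strong epimorphism followed by a monomorphism, $\mathsf T'$ preserves monomorphisms, and all components of $(\delta')^\dagger$ are monomorphisms. -/

import Mathlib

open CategoryTheory CategoryTheory.Limits Opposite
open FirstOrder.Language.Structure (funMap)
open scoped FirstOrder

universe u v w

set_option linter.unusedSectionVars false
set_option linter.unusedVariables false

namespace MVLogic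

/-! ### Algebras, semi-primality and bounded lattice reducts

A signature is a first-order language without relation symbols. -/

section Basic

variable (Lang : FirstOrder.Language.{v, w}) (D : Type u) [Lang.Structure D]

/-- Semi-primality (for a finite algebra): every operation of positive arity which preserves all
subalgebras is term-definable. -/
class IsSemiPrimal : Prop where
  definable : ∀ n : ℕ, 1 ≤ n → ∀ f : (Fin n → D) → D,
    (∀ S : Lang.Substructure D, ∀ x : Fin n → D, (∀ i, x i ∈ S) → f x ∈ S) →
    ∃ t : Lang.Term (Fin n), ∀ x, t.realize x = f x

/-- A bounded lattice reduct: the bounded lattice operations of `D` are given by terms (for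
instance, by basic operations) of the signature. -/
class BoundedLatticeReduct [Lattice D] [BoundedOrder D] where
  inf : Lang.Term (Fin 2)
  sup : Lang.Term (Fin 2)
  bot : Lang.Term (Fin 0)
  top : Lang.Term (Fin 0)
  realize_inf : ∀ x : Fin 2 → D, inf.realize x = x 0 ⊓ x 1
  realize_sup : ∀ x : Fin 2 → D, sup.realize x = x 0 ⊔ x 1
  realize_bot : ∀ x : Fin 0 → D, bot.realize x = ⊥
  realize_top : ∀ x : Fin 0 → D, top.realize x = ⊤

variable {Lang} in
/-- `A` satisfies every equation which holds in `D`. -/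
def SatisfiesEquations (A : Type u) [Lang.Structure A] : Prop :=
  ∀ (n : ℕ) (s t : Lang.Term (Fin n)),
    (∀ x : Fin n → D, s.realize x = t.realize x) → ∀ x : Fin n → A, s.realize x = t.realize x

/-- The variety generated by `D`: the algebras which satisfy all equations of `D`. -/
structure Variety where
  carrier : Type u
  [str : Lang.Structure carrier]
  sat : SatisfiesEquations (Lang := Lang) D carrier

attribute [instance] Variety.str

variable {Lang D}

namespace Variety

@[ext]
structure Hom (A B : Variety Lang D) where
  hom : A.carrier →[Lang] B.carrier

instance : Category (Variety Lang D) where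
  Hom A B := Hom A B
  id A := ⟨FirstOrder.Language.Hom.id Lang A.carrier⟩
  comp f g := ⟨g.hom.comp f.hom⟩

@[simp] lemma id_hom (A : Variety Lang D) : Hom.hom (𝟙 A) = FirstOrder.Language.Hom.id Lang A.carrier := rfl

@[simp] lemma comp_hom {A B C : Variety Lang D} (f : A ⟶ B) (g : B ⟶ C) :
    Hom.hom (f ≫ g) = g.hom.comp f.hom := rfl

lemma hom_ext {A B : Variety Lang D} {f g : A ⟶ B} (h : ∀ a, f.hom a = g.hom a) : f = g :=
  Hom.ext (FirstOrder.Language.Hom.ext h)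

end Variety

section

variable [Lang.IsAlgebraic]

/-- Without relation symbols, a homomorphism is a map which preserves the operations. -/
def mkHom {A B : Type*} [Lang.Structure A] [Lang.Structure B] (f : A → B)
    (hf : ∀ (n : ℕ) (g : Lang.Functions n) (x : Fin n → A),
      f (funMap g x) = funMap g (fun i => f (x i))) : A →[Lang] B where
  toFun := f
  map_fun' := fun {n} g x => hf n g x
  map_rel' := fun r _ _ => isEmptyElim r

@[simp] lemma mkHom_apply {A B : Type*} [Lang.Structure A] [Lang.Structure B] (f : A → B)
    (hf : ∀ (n : ℕ) (g : Lang.Functions n) (x : Fin n → A),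
      f (funMap g x) = funMap g (fun i => f (x i))) (a : A) :
    mkHom f hf a = f a := rfl

lemma satisfiesEquations_of_jointly_injective {A : Type u} [Lang.Structure A] {ι : Type*}
    (B : ι → Type u) [∀ i, Lang.Structure (B i)]
    (hB : ∀ i, SatisfiesEquations (Lang := Lang) D (B i)) (f : ∀ i, A →[Lang] B i)
    (hf : ∀ a b, (∀ i, f i a = f i b) → a = b) : SatisfiesEquations (Lang := Lang) D A := by
  intro n s t h x
  refine hf _ _ fun i => ?_
  rw [← FirstOrder.Language.HomClass.realize_term, ← FirstOrder.Language.HomClass.realize_term]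
  exact hB i n s t h _

lemma satisfiesEquations_self : SatisfiesEquations (Lang := Lang) D D := fun _ _ _ h x => h x

/-- An algebra whose operations are the given ones (there are no relations). -/
@[reducible] def mkStructure {A : Type*} (F : ∀ n : ℕ, Lang.Functions n → (Fin n → A) → A) :
    Lang.Structure A where
  funMap := fun {n} g x => F n g x
  RelMap := fun r _ => isEmptyElim r

/-! ### Limits in the variety -/

namespace Variety

variable {J : Type u} [SmallCategory J] (F : J ⥤ Variety Lang D)

/-- The compatible families in a diagram of algebras. -/
def LimitCarrier : Type u :=
  {x : ∀ j, (F.obj j).carrier // ∀ {i j : J} (f : i ⟶ j), (F.map f).hom (x i) = x j}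

instance : Lang.Structure (LimitCarrier F) :=
  mkStructure fun n g x => ⟨fun j => funMap g (fun k => (x k).1 j), fun {i j} f => by
    rw [FirstOrder.Language.Hom.map_fun]
    congr 1
    funext k
    exact (x k).2 f⟩

def limitProj (j : J) : LimitCarrier F →[Lang] (F.obj j).carrier :=
  mkHom (fun x => x.1 j) (fun _ _ _ => rfl)

def limitCone : Cone F where
  pt :=
    { carrier := LimitCarrier F
      sat := satisfiesEquations_of_jointly_injective (fun j => (F.obj j).carrier)
        (fun j => (F.obj j).sat) (limitProj F) (fun _ _ h => Subtype.ext (funext h)) }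
  π :=
    { app := fun j => ⟨limitProj F j⟩
      naturality := fun i j f => hom_ext fun x => (x.2 f).symm }

def limitConeIsLimit : IsLimit (limitCone F) where
  lift s := ⟨mkHom (fun a => ⟨fun j => (s.π.app j).hom a, fun {_ _} f =>
      DFunLike.congr_fun (congrArg Hom.hom (s.w f)) a⟩) (fun n g x => Subtype.ext (funext fun j => by
        exact FirstOrder.Language.Hom.map_fun _ g x))⟩
  fac s j := rfl
  uniq s m h := hom_ext fun a => Subtype.ext (funext fun j =>
    DFunLike.congr_fun (congrArg Hom.hom (h j)) a)

instance : HasLimitsOfSize.{u, u} (Variety Lang D) :=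
  ⟨fun _ _ => ⟨fun F => ⟨⟨⟨limitCone F, limitConeIsLimit F⟩⟩⟩⟩⟩

end Variety

end

end Basic

/-! ### The category `Set_D` -/

section SetD

variable (Lang : FirstOrder.Language.{v, w}) (D : Type u) [Lang.Structure D]

/-- Objects of `Set_D`: sets in which every point carries a subalgebra of `D`. -/
structure SetD where
  carrier : Type u
  val : carrier → Lang.Substructure D

variable {Lang D}

namespace SetD

@[ext]
structure Hom (X Y : SetD Lang D) where
  toFun : X.carrier → Y.carrier
  val_le : ∀ x, Y.val (toFun x) ≤ X.val x

instance : Category (SetD Lang D) where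
  Hom X Y := Hom X Y
  id X := ⟨id, fun _ => le_rfl⟩
  comp f g := ⟨g.toFun ∘ f.toFun, fun x => (g.val_le _).trans (f.val_le x)⟩

@[simp] lemma id_toFun (X : SetD Lang D) : Hom.toFun (𝟙 X) = id := rfl

@[simp] lemma comp_toFun {X Y Z : SetD Lang D} (f : X ⟶ Y) (g : Y ⟶ Z) :
    Hom.toFun (f ≫ g) = g.toFun ∘ f.toFun := rfl

lemma hom_ext {X Y : SetD Lang D} {f g : X ⟶ Y} (h : ∀ x, f.toFun x = g.toFun x) : f = g :=
  Hom.ext (funext h)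

variable (Lang D) in
/-- The forgetful functor. -/
def U : SetD Lang D ⥤ Type u where
  obj X := X.carrier
  map f := TypeCat.ofHom f.toFun

variable {J : Type u} [SmallCategory J] (F : J ⥤ SetD Lang D)

/-- Colimits are formed as in sets, with the largest admissible valuation. -/
noncomputable def colimitCocone : Cocone F where
  pt :=
    { carrier := colimit (F ⋙ U Lang D)
      val := fun z => ⨅ (j : J) (x : (F.obj j).carrier)
        (_ : (colimit.ι (F ⋙ U Lang D) j : _ → _) x = z), (F.obj j).val x }
  ι :=
    { app := fun j => ⟨fun x => (colimit.ι (F ⋙ U Lang D) j : _ → _) x, fun x =>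
        iInf_le_of_le j (iInf_le_of_le x (iInf_le_of_le rfl le_rfl))⟩
      naturality := fun i j f => hom_ext fun x => by
        have := ConcreteCategory.congr_hom (colimit.w (F ⋙ U Lang D) f) x
        exact this }

noncomputable def colimitCoconeIsColimit : IsColimit (colimitCocone F) where
  desc s := ⟨fun z => (colimit.desc (F ⋙ U Lang D) ((U Lang D).mapCocone s) : _ → _) z, fun z => by
    refine le_iInf fun j => le_iInf fun x => le_iInf fun h => ?_
    subst h
    have := ConcreteCategory.congr_hom
      (colimit.ι_desc ((U Lang D).mapCocone s) j) x
    change s.pt.val ((colimit.ι (F ⋙ U Lang D) j ≫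
      colimit.desc (F ⋙ U Lang D) ((U Lang D).mapCocone s) : _ → _) x) ≤ _
    rw [this]
    exact (s.ι.app j).val_le x⟩
  fac s j := hom_ext fun x =>
    ConcreteCategory.congr_hom (colimit.ι_desc ((U Lang D).mapCocone s) j) x
  uniq s m h := hom_ext fun z => by
    have : (U Lang D).map m = colimit.desc (F ⋙ U Lang D) ((U Lang D).mapCocone s) := by
      refine colimit.hom_ext fun j => ?_
      rw [colimit.ι_desc]
      exact (congrArg (U Lang D).map (h j))
    exact ConcreteCategory.congr_hom this z

instance : HasColimitsOfSize.{u, u} (SetD Lang D) :=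
  ⟨fun _ _ => ⟨fun F => ⟨⟨⟨colimitCocone F, colimitCoconeIsColimit F⟩⟩⟩⟩⟩

end SetD

end SetD

/-! ### Terms, and the Boolean skeleton -/

section Skeleton

variable (Lang : FirstOrder.Language.{v, w}) (D : Type u) [Lang.Structure D] [Lattice D]
  [BoundedOrder D] [BoundedLatticeReduct Lang D]

section Ops

variable {M : Type*} [Lang.Structure M]

/-- The interpretation of the lattice terms in an arbitrary algebra. -/
def opInf (a b : M) : M := (BoundedLatticeReduct.inf D : Lang.Term (Fin 2)).realize ![a, b]

def opSup (a b : M) : M := (BoundedLatticeReduct.sup D : Lang.Term (Fin 2)).realize ![a, b]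

def opBot : M := (BoundedLatticeReduct.bot D : Lang.Term (Fin 0)).realize ![]

def opTop : M := (BoundedLatticeReduct.top D : Lang.Term (Fin 0)).realize ![]

def tInf {n : ℕ} (s t : Lang.Term (Fin n)) : Lang.Term (Fin n) :=
  (BoundedLatticeReduct.inf D : Lang.Term (Fin 2)).subst ![s, t]

def tSup {n : ℕ} (s t : Lang.Term (Fin n)) : Lang.Term (Fin n) :=
  (BoundedLatticeReduct.sup D : Lang.Term (Fin 2)).subst ![s, t]

def tBot {n : ℕ} : Lang.Term (Fin n) :=
  (BoundedLatticeReduct.bot D : Lang.Term (Fin 0)).subst ![]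

def tTop {n : ℕ} : Lang.Term (Fin n) :=
  (BoundedLatticeReduct.top D : Lang.Term (Fin 0)).subst ![]

lemma realize_tInf {n : ℕ} (s t : Lang.Term (Fin n)) (x : Fin n → M) :
    (tInf Lang D s t).realize x = opInf Lang D (s.realize x) (t.realize x) := by
  rw [tInf, FirstOrder.Language.Term.realize_subst, opInf]
  congr 1
  funext i
  fin_cases i <;> rfl

lemma realize_tSup {n : ℕ} (s t : Lang.Term (Fin n)) (x : Fin n → M) :
    (tSup Lang D s t).realize x = opSup Lang D (s.realize x) (t.realize x) := by
  rw [tSup, FirstOrder.Language.Term.realize_subst, opSup]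
  congr 1
  funext i
  fin_cases i <;> rfl

lemma realize_tBot {n : ℕ} (x : Fin n → M) : (tBot Lang D).realize x = opBot Lang D := by
  rw [tBot, FirstOrder.Language.Term.realize_subst, opBot]
  congr 1
  funext i
  exact i.elim0

lemma realize_tTop {n : ℕ} (x : Fin n → M) : (tTop Lang D).realize x = opTop Lang D := by
  rw [tTop, FirstOrder.Language.Term.realize_subst, opTop]
  congr 1
  funext i
  exact i.elim0

lemma opInf_self (a b : D) : opInf Lang D a b = a ⊓ b := BoundedLatticeReduct.realize_inf _

lemma opSup_self (a b : D) : opSup Lang D a b = a ⊔ b := BoundedLatticeReduct.realize_sup _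

lemma opBot_self : (opBot Lang D : D) = ⊥ := BoundedLatticeReduct.realize_bot _

lemma opTop_self : (opTop Lang D : D) = ⊤ := BoundedLatticeReduct.realize_top _

end Ops

variable {D} in
lemma bot_mem (S : Lang.Substructure D) : (⊥ : D) ∈ S := by
  rw [← BoundedLatticeReduct.realize_bot (Lang := Lang) (D := D) Fin.elim0]
  exact FirstOrder.Language.Term.realize_mem _ _ (fun i => Fin.elim0 i)

variable {D} in
lemma top_mem (S : Lang.Substructure D) : (⊤ : D) ∈ S := by
  rw [← BoundedLatticeReduct.realize_top (Lang := Lang) (D := D) Fin.elim0]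
  exact FirstOrder.Language.Term.realize_mem _ _ (fun i => Fin.elim0 i)

variable [IsSemiPrimal Lang D]

open Classical in
lemma exists_termT (d : D) : ∃ t : Lang.Term (Fin 1), ∀ x : Fin 1 → D,
    t.realize x = if x 0 = d then ⊤ else ⊥ := by
  refine IsSemiPrimal.definable 1 le_rfl (fun x => if x 0 = d then ⊤ else ⊥) fun S x _ => ?_
  by_cases h : x 0 = d
  · simpa only [if_pos h] using top_mem Lang S
  · simpa only [if_neg h] using bot_mem Lang S

/-- A unary term defining the operation `T_d` of `D`. -/
noncomputable def termT (d : D) : Lang.Term (Fin 1) := (exists_termT Lang D d).choose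

/-- The interpretation of `T_d` in an arbitrary algebra. -/
noncomputable def opT {M : Type*} [Lang.Structure M] (d : D) (a : M) : M :=
  (termT Lang D d).realize ![a]

noncomputable def tT {n : ℕ} (d : D) (s : Lang.Term (Fin n)) : Lang.Term (Fin n) :=
  (termT Lang D d).subst ![s]

lemma realize_tT {M : Type*} [Lang.Structure M] {n : ℕ} (d : D) (s : Lang.Term (Fin n))
    (x : Fin n → M) : (tT Lang D d s).realize x = opT Lang D d (s.realize x) := by
  rw [tT, FirstOrder.Language.Term.realize_subst, opT]
  congr 1
  funext i
  fin_cases i; rfl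

open Classical in
lemma opT_self (d a : D) : opT Lang D d a = if a = d then ⊤ else ⊥ :=
  (exists_termT Lang D d).choose_spec ![a]

section Hom

variable {M N : Type*} [Lang.Structure M] [Lang.Structure N] (f : M →[Lang] N)

lemma map_opInf (a b : M) : f (opInf Lang D a b) = opInf Lang D (f a) (f b) := by
  rw [opInf, ← FirstOrder.Language.HomClass.realize_term, opInf]
  congr 1
  funext i
  fin_cases i <;> rfl

lemma map_opSup (a b : M) : f (opSup Lang D a b) = opSup Lang D (f a) (f b) := by
  rw [opSup, ← FirstOrder.Language.HomClass.realize_term, opSup]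
  congr 1
  funext i
  fin_cases i <;> rfl

lemma map_opBot : f (opBot Lang D) = opBot Lang D := by
  rw [opBot, ← FirstOrder.Language.HomClass.realize_term, opBot]
  congr 1
  funext i
  exact i.elim0

lemma map_opTop : f (opTop Lang D) = opTop Lang D := by
  rw [opTop, ← FirstOrder.Language.HomClass.realize_term, opTop]
  congr 1
  funext i
  exact i.elim0

lemma map_opT (d : D) (a : M) : f (opT Lang D d a) = opT Lang D d (f a) := by
  rw [opT, ← FirstOrder.Language.HomClass.realize_term, opT]
  congr 1
  funext i
  fin_cases i; rfl

end Hom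

variable {Lang D}

/-- The carrier of the Boolean skeleton. -/
@[ext]
structure Skel (A : Variety Lang D) : Type u where
  val : A.carrier
  property : opT Lang D ⊤ val = val

namespace Skel

variable [Nontrivial D] {A : Variety Lang D}

open FirstOrder.Language.Term (var)

/-- An equation in at most three variables transfers from `D` to the skeleton. -/
lemma law (s t : Lang.Term (Fin 3))
    (h : ∀ x : Fin 3 → D, s.realize x = t.realize x) (a b c : A.carrier) :
    s.realize ![a, b, c] = t.realize ![a, b, c] := A.sat 3 s t h _

instance : Max (Skel A) := ⟨fun a b => ⟨opSup Lang D a.val b.val, by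
  have := law (A := A) (tT Lang D ⊤ (tSup Lang D (tT Lang D ⊤ (var 0)) (tT Lang D ⊤ (var 1))))
    (tSup Lang D (tT Lang D ⊤ (var 0)) (tT Lang D ⊤ (var 1))) (fun x => by
      simp only [realize_tT, realize_tSup, opT_self, opSup_self]
      by_cases h0 : x 0 = ⊤ <;> by_cases h1 : x 1 = ⊤ <;> simp [h0, h1]) a.val b.val a.val
  simpa [realize_tT, realize_tSup, a.property, b.property] using this⟩⟩

instance : Min (Skel A) := ⟨fun a b => ⟨opInf Lang D a.val b.val, by
  have := law (A := A) (tT Lang D ⊤ (tInf Lang D (tT Lang D ⊤ (var 0)) (tT Lang D ⊤ (var 1))))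
    (tInf Lang D (tT Lang D ⊤ (var 0)) (tT Lang D ⊤ (var 1))) (fun x => by
      simp only [realize_tT, realize_tInf, opT_self, opInf_self]
      by_cases h0 : x 0 = ⊤ <;> by_cases h1 : x 1 = ⊤ <;> simp [h0, h1]) a.val b.val a.val
  simpa [realize_tT, realize_tInf, a.property, b.property] using this⟩⟩

lemma coe_sup (a b : Skel A) : (a ⊔ b).val = opSup Lang D a.val b.val := rfl

lemma coe_inf (a b : Skel A) : (a ⊓ b).val = opInf Lang D a.val b.val := rfl

instance : Lattice (Skel A) := Lattice.mk'
  (fun a b => Skel.ext (by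
    simpa [realize_tSup, coe_sup] using law (A := A) (tSup Lang D (var 0) (var 1))
      (tSup Lang D (var 1) (var 0))
      (fun x => by simp [realize_tSup, opSup_self, sup_comm]) a.val b.val a.val))
  (fun a b c => Skel.ext (by
    simpa [realize_tSup, coe_sup] using law (A := A)
      (tSup Lang D (tSup Lang D (var 0) (var 1)) (var 2))
      (tSup Lang D (var 0) (tSup Lang D (var 1) (var 2)))
      (fun x => by simp [realize_tSup, opSup_self, sup_assoc]) a.val b.val c.val))
  (fun a b => Skel.ext (by
    simpa [realize_tInf, coe_inf] using law (A := A) (tInf Lang D (var 0) (var 1))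
      (tInf Lang D (var 1) (var 0))
      (fun x => by simp [realize_tInf, opInf_self, inf_comm]) a.val b.val a.val))
  (fun a b c => Skel.ext (by
    simpa [realize_tInf, coe_inf] using law (A := A)
      (tInf Lang D (tInf Lang D (var 0) (var 1)) (var 2))
      (tInf Lang D (var 0) (tInf Lang D (var 1) (var 2)))
      (fun x => by simp [realize_tInf, opInf_self, inf_assoc]) a.val b.val c.val))
  (fun a b => Skel.ext (by
    simpa [realize_tInf, realize_tSup, coe_inf, coe_sup] using law (A := A)
      (tSup Lang D (var 0) (tInf Lang D (var 0) (var 1))) (var 0)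
      (fun x => by simp [realize_tInf, realize_tSup, opInf_self, opSup_self]) a.val b.val a.val))
  (fun a b => Skel.ext (by
    simpa [realize_tInf, realize_tSup, coe_inf, coe_sup] using law (A := A)
      (tInf Lang D (var 0) (tSup Lang D (var 0) (var 1))) (var 0)
      (fun x => by simp [realize_tInf, realize_tSup, opInf_self, opSup_self]) a.val b.val a.val))

/-- The Boolean skeleton: lattice operations inherited from `A`, with complement `T_0`. -/
noncomputable instance : BooleanAlgebra (Skel A) where
  le_sup_inf a b c := by
    have h : ((a ⊔ b) ⊓ (a ⊔ c)).val = (a ⊔ b ⊓ c).val := by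
      have := law (A := A)
        (tInf Lang D (tSup Lang D (tT Lang D ⊤ (var 0)) (tT Lang D ⊤ (var 1)))
          (tSup Lang D (tT Lang D ⊤ (var 0)) (tT Lang D ⊤ (var 2))))
        (tSup Lang D (tT Lang D ⊤ (var 0))
          (tInf Lang D (tT Lang D ⊤ (var 1)) (tT Lang D ⊤ (var 2))))
        (fun x => by
          simp only [realize_tT, realize_tInf, realize_tSup, opT_self, opInf_self, opSup_self]
          by_cases h0 : x 0 = ⊤ <;> by_cases h1 : x 1 = ⊤ <;> by_cases h2 : x 2 = ⊤ <;>
          simp [h0, h1, h2]) a.val b.val c.val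
      simpa [realize_tT, realize_tInf, realize_tSup, coe_inf, coe_sup, a.property, b.property, c.property] using this
    exact (Skel.ext h).le
  compl a := ⟨opT Lang D ⊥ a.val, by
    have := law (A := A) (tT Lang D ⊤ (tT Lang D ⊥ (var 0))) (tT Lang D ⊥ (var 0)) (fun x => by
      simp only [realize_tT, opT_self]
      by_cases h0 : x 0 = ⊥ <;> simp [h0]) a.val a.val a.val
    simpa [realize_tT] using this⟩
  top := ⟨opTop Lang D, by
    have := law (A := A) (tT Lang D ⊤ (tTop Lang D)) (tTop Lang D) (fun x => by
      simp [realize_tT, opT_self, realize_tTop, opTop_self]) (opTop Lang D) (opTop Lang D)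
      (opTop Lang D)
    simpa [realize_tT, realize_tTop] using this⟩
  bot := ⟨opBot Lang D, by
    have := law (A := A) (tT Lang D ⊤ (tBot Lang D)) (tBot Lang D) (fun x => by
      simp [realize_tT, opT_self, realize_tBot, opBot_self]) (opTop Lang D) (opTop Lang D)
      (opTop Lang D)
    simpa [realize_tT, realize_tBot] using this⟩
  inf_compl_le_bot a := by
    refine le_of_eq (Skel.ext ?_)
    have := law (A := A) (tInf Lang D (tT Lang D ⊤ (var 0)) (tT Lang D ⊥ (tT Lang D ⊤ (var 0))))
      (tBot Lang D) (fun x => by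
        simp only [realize_tT, opT_self, realize_tBot, opBot_self, realize_tInf, opInf_self]
        by_cases h0 : x 0 = ⊤ <;> simp [h0]) a.val a.val a.val
    simpa [realize_tT, realize_tBot, realize_tInf, a.property, coe_inf] using this
  top_le_sup_compl a := by
    refine le_of_eq (Skel.ext ?_)
    have := law (A := A) (tTop Lang D)
      (tSup Lang D (tT Lang D ⊤ (var 0)) (tT Lang D ⊥ (tT Lang D ⊤ (var 0)))) (fun x => by
        simp only [realize_tT, opT_self, realize_tTop, opTop_self, realize_tSup, opSup_self]
        by_cases h0 : x 0 = ⊤ <;> simp [h0]) a.val a.val a.val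
    simpa [realize_tT, realize_tTop, realize_tSup, a.property, coe_sup] using this
  le_top a := by
    refine sup_eq_right.mp (Skel.ext ?_)
    rw [coe_sup]
    have := law (A := A) (tSup Lang D (var 0) (tTop Lang D)) (tTop Lang D) (fun x => by
        simp [realize_tTop, opTop_self, realize_tSup, opSup_self]) a.val a.val a.val
    simpa [realize_tTop, realize_tSup] using this
  bot_le a := by
    refine sup_eq_right.mp (Skel.ext ?_)
    rw [coe_sup]
    have := law (A := A) (tSup Lang D (tBot Lang D) (var 0)) (var 0) (fun x => by
        simp [realize_tBot, opBot_self, realize_tSup, opSup_self]) a.val a.val a.val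
    simpa [realize_tBot, realize_tSup] using this

end Skel

variable (Lang D) [Nontrivial D]

/-- The Boolean skeleton functor. -/
noncomputable def skeleton : Variety Lang D ⥤ BoolAlg.{u} where
  obj A := BoolAlg.of (Skel A)
  map f := BoolAlg.ofHom
    { toFun := fun a => ⟨f.hom a.val, by rw [← map_opT, a.property]⟩
      map_sup' := fun a b => Skel.ext (map_opSup Lang D f.hom a.val b.val)
      map_inf' := fun a b => Skel.ext (map_opInf Lang D f.hom a.val b.val)
      map_top' := Skel.ext (map_opTop Lang D f.hom)
      map_bot' := Skel.ext (map_opBot Lang D f.hom) }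

end Skeleton

/-! ### The quotients of an algebra, and the functors `K_S` -/

section Quotients

variable {Lang : FirstOrder.Language.{v, w}} [Lang.IsAlgebraic] {D : Type u} [Lang.Structure D]

/-- The congruence identifying elements which have the same value under every homomorphism into
`D` with image in `S`. -/
def congr (S : Lang.Substructure D) (A : Variety Lang D) : Setoid A.carrier where
  r a b := ∀ u : A.carrier →[Lang] D, (∀ c, u c ∈ S) → u a = u b
  iseqv := ⟨fun _ _ _ => rfl, fun h u hu => (h u hu).symm,
    fun h k u hu => (h u hu).trans (k u hu)⟩

instance (S : Lang.Substructure D) (A : Variety Lang D) : Lang.Prestructure (congr S A) where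
  toStructure := A.str
  fun_equiv := fun {n f} x y h u hu => by
    rw [FirstOrder.Language.Hom.map_fun, FirstOrder.Language.Hom.map_fun]
    congr 1
    funext i
    exact h i u hu
  rel_equiv := fun {n r} _ _ _ => isEmptyElim r

def quotObj (S : Lang.Substructure D) (A : Variety Lang D) : Variety Lang D where
  carrier := Quotient (congr S A)
  sat n s t h x := by
    obtain ⟨y, rfl⟩ : ∃ y : Fin n → A.carrier, (fun i => Quotient.mk (congr S A) (y i)) = x :=
      ⟨fun i => (x i).out, funext fun i => Quotient.out_eq _⟩
    rw [FirstOrder.Language.Term.realize_quotient_mk',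
      FirstOrder.Language.Term.realize_quotient_mk']
    exact congrArg _ (A.sat n s t h y)

def quotHom {S S' : Lang.Substructure D} (h : S' ≤ S) {A B : Variety Lang D} (f : A ⟶ B) :
    quotObj S A ⟶ quotObj S' B :=
  ⟨mkHom (A := Quotient (congr S A)) (B := Quotient (congr S' B))
    (Quotient.map f.hom (fun a b hab u hu => hab (u.comp f.hom) (fun c => h (hu _))))
    (fun n g x => by
      obtain ⟨y, rfl⟩ : ∃ y : Fin n → A.carrier, (fun i => Quotient.mk (congr S A) (y i)) = x :=
        ⟨fun i => (x i).out, funext fun i => Quotient.out_eq _⟩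
      refine (congrArg _ (FirstOrder.Language.funMap_quotient_mk' (congr S A) g y)).trans ?_
      refine Eq.trans ?_ (FirstOrder.Language.funMap_quotient_mk' (congr S' B) g
        (fun i => f.hom (y i))).symm
      exact congrArg (Quotient.mk (congr S' B)) (FirstOrder.Language.Hom.map_fun f.hom g y))⟩

variable (Lang D) in
/-- The quotient `A / θ_S`, functorial in `A` and contravariant in `S`. -/
def quotFunctor : (Lang.Substructure D)ᵒᵖ ⥤ Variety Lang D ⥤ Variety Lang D where
  obj S :=
    { obj := quotObj S.unop
      map := quotHom le_rfl
      map_id := fun A => Variety.hom_ext fun a => by induction a using Quotient.ind; rfl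
      map_comp := fun f g => Variety.hom_ext fun a => by induction a using Quotient.ind; rfl }
  map h :=
    { app := fun A => quotHom (leOfHom h.unop) (𝟙 A)
      naturality := fun A B f => Variety.hom_ext fun a => by induction a using Quotient.ind; rfl }
  map_id S := by
    ext A : 2
    exact Variety.hom_ext fun a => by induction a using Quotient.ind; rfl
  map_comp f g := by
    ext A : 2
    exact Variety.hom_ext fun a => by induction a using Quotient.ind; rfl

variable [Lattice D] [BoundedOrder D] [Nontrivial D] [BoundedLatticeReduct Lang D]
  [IsSemiPrimal Lang D]

variable (Lang D) in
/-- `K_S A` is the Boolean skeleton of `A / θ_S`. -/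
noncomputable def functorK : (Lang.Substructure D)ᵒᵖ ⥤ Variety Lang D ⥤ BoolAlg.{u} :=
  quotFunctor Lang D ⋙ (Functor.whiskeringRight _ _ _).obj (skeleton Lang D)

end Quotients

/-! ### Boolean powers -/

section BooleanPower

variable {Lang : FirstOrder.Language.{v, w}} [Lang.IsAlgebraic] {D : Type u} [Lang.Structure D]
  [Fintype D]

/-- The Boolean power `S[B]` of a subalgebra `S` of `D`: the families `(ξ d)` of pairwise
disjoint elements of `B` with join `⊤`. The index runs through all of `D`, with `ξ d = ⊥` for `d`
outside of `S`. -/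
@[ext]
structure BoolPower (S : Lang.Substructure D) (B : Type u) [BooleanAlgebra B] : Type u where
  val : D → B
  disjoint : ∀ d e, d ≠ e → Disjoint (val d) (val e)
  sup_eq : Finset.univ.sup val = ⊤
  support : ∀ d, d ∉ S → val d = ⊥

namespace BoolPower

variable {S : Lang.Substructure D} {B : Type u} [BooleanAlgebra B]

/-- The part of `B` on which the argument tuple has value `y`. -/
def cell {n : ℕ} (x : Fin n → BoolPower S B) (y : Fin n → D) : B :=
  Finset.univ.inf fun i => (x i).val (y i)

lemma cell_le {n : ℕ} (x : Fin n → BoolPower S B) (y : Fin n → D) (i : Fin n) :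
    cell x y ≤ (x i).val (y i) := Finset.inf_le (Finset.mem_univ i)

lemma cell_disjoint {n : ℕ} (x : Fin n → BoolPower S B) {y z : Fin n → D} (h : y ≠ z) :
    Disjoint (cell x y) (cell x z) := by
  obtain ⟨i, hi⟩ := Function.ne_iff.mp h
  exact ((x i).disjoint _ _ hi).mono (cell_le x y i) (cell_le x z i)

lemma sup_cell {n : ℕ} (x : Fin n → BoolPower S B) :
    Finset.univ.sup (fun y : Fin n → D => cell x y) = ⊤ := by
  have h : (⊤ : B) = Finset.univ.inf fun i => Finset.univ.sup (x i).val := by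
    simp only [(x _).sup_eq]
    exact (Finset.inf_top _).symm
  refine top_unique ?_
  rw [h, Finset.inf_sup]
  refine Finset.sup_le fun g _ => ?_
  refine le_trans ?_ (Finset.le_sup (f := fun y : Fin n → D => cell x y)
    (Finset.mem_univ fun i => g i (Finset.mem_univ i)))
  exact Finset.le_inf fun i _ =>
    Finset.inf_le (f := fun i : {i // i ∈ (Finset.univ : Finset (Fin n))} =>
      (x i.1).val (g i.1 i.2)) (Finset.mem_attach _ ⟨i, Finset.mem_univ i⟩)

open Classical in
/-- The value of an operation at `d` is the join of the `ξ₁ (y₁) ⊓ … ⊓ ξₙ (yₙ)` over all tuples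
`y` at which the operation of `D` has value `d`. -/
noncomputable def apply {n : ℕ} (g : Lang.Functions n) (x : Fin n → BoolPower S B) :
    BoolPower S B where
  val d := (Finset.univ.filter fun y : Fin n → D => funMap g y = d).sup (cell x)
  disjoint d e hde := by
    rw [Finset.disjoint_sup_left]
    intro y hy
    rw [Finset.disjoint_sup_right]
    intro z hz
    refine cell_disjoint x fun h => hde ?_
    subst h
    rw [← (Finset.mem_filter.mp hy).2, ← (Finset.mem_filter.mp hz).2]
  sup_eq := by
    refine top_unique ?_
    rw [← sup_cell x]
    refine Finset.sup_le fun y _ => ?_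
    refine le_trans ?_ (Finset.le_sup (Finset.mem_univ (funMap g y)))
    exact Finset.le_sup (f := cell x) (Finset.mem_filter.mpr ⟨Finset.mem_univ y, rfl⟩)
  support d hd := by
    refine bot_unique (Finset.sup_le fun y hy => ?_)
    have : ∃ i, y i ∉ S := by
      by_contra! h
      exact hd ((Finset.mem_filter.mp hy).2 ▸ S.fun_mem g y h)
    obtain ⟨i, hi⟩ := this
    exact (cell_le x y i).trans ((x i).support _ hi).le

noncomputable instance : Lang.Structure (BoolPower S B) := mkStructure fun _ g x => apply g x

open Classical in
lemma cell_le_realize {n : ℕ} (t : Lang.Term (Fin n)) (x : Fin n → BoolPower S B)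
    (y : Fin n → D) : cell x y ≤ (t.realize x).val (t.realize y) := by
  induction t with
  | var i => exact cell_le x y i
  | func g ts ih =>
    refine le_trans ?_ (Finset.le_sup (f := cell fun i => (ts i).realize x)
      (Finset.mem_filter.mpr ⟨Finset.mem_univ (fun i => (ts i).realize y), rfl⟩))
    exact Finset.le_inf fun i _ => ih i

lemma realize_le_realize {n : ℕ} (s t : Lang.Term (Fin n))
    (h : ∀ x : Fin n → D, s.realize x = t.realize x) (x : Fin n → BoolPower S B) (d : D) :
    (s.realize x).val d ≤ (t.realize x).val d := by
  rw [← inf_top_eq ((s.realize x).val d), ← sup_cell x, Finset.sup_inf_distrib_left]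
  refine Finset.sup_le fun y _ => ?_
  by_cases hy : s.realize y = d
  · refine inf_le_right.trans ((cell_le_realize t x y).trans ?_)
    rw [← h, hy]
  · have := ((s.realize x).disjoint _ _ hy).mono_left (cell_le_realize s x y)
    rw [inf_comm, this.eq_bot]
    exact bot_le

variable (S B) in
noncomputable def obj : Variety Lang D where
  carrier := BoolPower S B
  sat n s t h x := BoolPower.ext (funext fun d => le_antisymm (realize_le_realize s t h x d)
    (realize_le_realize t s (fun x => (h x).symm) x d))

/-- Boolean powers are functorial in the Boolean algebra and, by inclusion, in the subalgebra. -/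
noncomputable def map {S S' : Lang.Substructure D} (hS : S ≤ S') {B C : Type u}
    [BooleanAlgebra B] [BooleanAlgebra C] (f : BoundedLatticeHom B C) : obj S B ⟶ obj S' C :=
  ⟨mkHom (A := BoolPower S B) (B := BoolPower S' C)
    (fun ξ =>
      { val := fun d => f (ξ.val d)
        disjoint := fun d e h => by
          rw [disjoint_iff, ← map_inf, (ξ.disjoint d e h).eq_bot, map_bot]
        sup_eq := by
          have := congrArg f ξ.sup_eq
          rwa [map_finset_sup, map_top] at this
        support := fun d hd => by rw [ξ.support d (fun h => hd (hS h)), map_bot] })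
    (fun n g x => BoolPower.ext (funext fun d => by
      refine (map_finset_sup f _ _).trans ?_
      refine congrArg (Finset.sup _) (funext fun y => ?_)
      exact map_finset_inf f _ _))⟩

end BoolPower

variable (Lang D) in
noncomputable def functorP : Lang.Substructure D ⥤ BoolAlg.{u} ⥤ Variety Lang D where
  obj S :=
    { obj := fun B => BoolPower.obj S B
      map := fun f => BoolPower.map le_rfl f.hom
      map_id := fun B => Variety.hom_ext fun ξ => BoolPower.ext (funext fun d => rfl)
      map_comp := fun f g => Variety.hom_ext fun ξ => BoolPower.ext (funext fun d => rfl) }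
  map h :=
    { app := fun B => BoolPower.map (leOfHom h) (BoundedLatticeHom.id B)
      naturality := fun A B f => Variety.hom_ext fun ξ => BoolPower.ext (funext fun d => rfl) }
  map_id S := by
    ext B : 2
    exact Variety.hom_ext fun ξ => BoolPower.ext (funext fun d => rfl)
  map_comp f g := by
    ext B : 2
    exact Variety.hom_ext fun ξ => BoolPower.ext (funext fun d => rfl)

end BooleanPower

/-! ### The functors `V^S`, `C^S`, and the dual adjunction between `Set_D` and the variety -/

section SetDFunctors

variable (Lang : FirstOrder.Language.{v, w}) (D : Type u) [Lang.Structure D]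

/-- `V^S X` is `X` with the constant valuation `S`. -/
def functorV : (Lang.Substructure D)ᵒᵖ ⥤ Type u ⥤ SetD Lang D where
  obj S :=
    { obj := fun X => ⟨X, fun _ => S.unop⟩
      map := fun f => ⟨fun x => f x, fun _ => le_rfl⟩ }
  map h := { app := fun X => ⟨fun x => x, fun _ => leOfHom h.unop⟩ }

/-- `C^S (X, v)` is the set of points `x` with `v x ≤ S`. -/
def functorC : Lang.Substructure D ⥤ SetD Lang D ⥤ Type u where
  obj S :=
    { obj := fun X => {x : X.carrier // X.val x ≤ S}
      map := fun f => TypeCat.ofHom fun x => ⟨f.toFun x.1, (f.val_le x.1).trans x.2⟩ }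
  map h := { app := fun X => TypeCat.ofHom fun x => ⟨x.1, x.2.trans (leOfHom h)⟩ }

variable [Lang.IsAlgebraic]

variable {Lang D} in
/-- The set of homomorphisms from `A` to `D`, the valuation being the image. -/
def homObj (A : Variety Lang D) : SetD Lang D := ⟨A.carrier →[Lang] D, fun u => u.range⟩

variable {Lang D} in
def homMap {A B : Variety Lang D} (f : A ⟶ B) : homObj B ⟶ homObj A :=
  ⟨fun u : B.carrier →[Lang] D => u.comp f.hom, fun u => by
    rintro _ ⟨a, rfl⟩
    exact ⟨f.hom a, rfl⟩⟩

/-- The functor `S'`, acting on homomorphisms by precomposition. -/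
def functorS' : Variety Lang D ⥤ (SetD Lang D)ᵒᵖ where
  obj A := op (homObj A)
  map f := (homMap f).op

variable {Lang D}

/-- The product of the subalgebras `v x`. -/
def ProdCarrier (X : SetD Lang D) : Type u := ∀ x : X.carrier, X.val x

instance (X : SetD Lang D) : Lang.Structure (ProdCarrier X) :=
  mkStructure fun _ g α => fun x => funMap g fun i => α i x

def ProdCarrier.ev (X : SetD Lang D) (x : X.carrier) : ProdCarrier X →[Lang] D :=
  mkHom (fun α => (α x : D)) (fun _ _ _ => rfl)

def prodObj (X : SetD Lang D) : Variety Lang D where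
  carrier := ProdCarrier X
  sat := satisfiesEquations_of_jointly_injective (fun _ : X.carrier => D)
    (fun _ => satisfiesEquations_self) (ProdCarrier.ev X)
    (fun _ _ h => funext fun x => Subtype.ext (h x))

variable (Lang D) in
/-- `P' (X, v)` is the product of the subalgebras `v x`. -/
def functorP' : (SetD Lang D)ᵒᵖ ⥤ Variety Lang D where
  obj X := prodObj X.unop
  map {X Y} f := ⟨mkHom (A := ProdCarrier X.unop) (B := ProdCarrier Y.unop)
    (fun α y => ⟨α (f.unop.toFun y), f.unop.val_le y (α _).2⟩) (fun _ _ _ => rfl)⟩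

def evalAlg (A : Variety Lang D) : A ⟶ prodObj (homObj A) :=
  ⟨mkHom (A := A.carrier) (B := ProdCarrier (homObj A))
    (fun a (u : A.carrier →[Lang] D) => ⟨u a, ⟨a, rfl⟩⟩)
    (fun n g x => funext fun (u : A.carrier →[Lang] D) =>
      Subtype.ext (FirstOrder.Language.Hom.map_fun u g x))⟩

def evalSet (X : SetD Lang D) : X ⟶ homObj (prodObj X) :=
  ⟨fun x => ProdCarrier.ev X x, fun x => by
    rintro _ ⟨α, rfl⟩
    exact ((α : ProdCarrier X) x).2⟩

variable (Lang D) in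
/-- The dual adjunction given by evaluations. -/
def adj' : functorS' Lang D ⊣ functorP' Lang D :=
  Adjunction.mkOfUnitCounit
    { unit := { app := fun A => evalAlg A, naturality := fun A B f => rfl }
      counit := { app := fun X => (evalSet X.unop).op, naturality := fun X Y f => rfl }
      left_triangle := rfl
      right_triangle := rfl }

end SetDFunctors

/-! ### The dual adjunction between sets and Boolean algebras -/

section Classical

/-- Ultrafilters of a Boolean algebra. -/
@[ext]
structure UltrafilterBA (B : Type u) [BooleanAlgebra B] : Type u where
  mem : B → Prop
  top_mem : mem ⊤
  inf_mem : ∀ a b, mem a → mem b → mem (a ⊓ b)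
  mono : ∀ a b, a ≤ b → mem a → mem b
  compl_mem_iff : ∀ a, mem aᶜ ↔ ¬ mem a

def UltrafilterBA.comap {A B : Type u} [BooleanAlgebra A] [BooleanAlgebra B]
    (f : BoundedLatticeHom A B) (F : UltrafilterBA B) : UltrafilterBA A where
  mem a := F.mem (f a)
  top_mem := by rw [map_top]; exact F.top_mem
  inf_mem a b ha hb := by rw [map_inf]; exact F.inf_mem _ _ ha hb
  mono a b h := F.mono _ _ (OrderHomClass.mono f h)
  compl_mem_iff a := by rw [map_compl']; exact F.compl_mem_iff _

/-- The ultrafilter functor. -/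
def functorS : BoolAlg.{u} ⥤ (Type u)ᵒᵖ where
  obj B := op (UltrafilterBA B)
  map f := (TypeCat.ofHom (UltrafilterBA.comap f.hom)).op

/-- The contravariant powerset functor. -/
def functorPow : (Type u)ᵒᵖ ⥤ BoolAlg.{u} := typeToBoolAlgOp.leftOp

/-- The dual adjunction given by evaluations. -/
def adjClassical : functorS.{u} ⊣ functorPow.{u} :=
  Adjunction.mkOfUnitCounit
    { unit :=
        { app := fun B => BoolAlg.ofHom (X := B) (Y := Set (UltrafilterBA B))
            { toFun := fun b => {F | F.mem b}
              map_sup' := fun a b => by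
                ext F
                change F.mem (a ⊔ b) ↔ F.mem a ∨ F.mem b
                refine ⟨fun h => ?_, fun h => h.elim (F.mono _ _ le_sup_left)
                  (F.mono _ _ le_sup_right)⟩
                by_contra hab
                rw [not_or, ← F.compl_mem_iff, ← F.compl_mem_iff] at hab
                refine (F.compl_mem_iff (a ⊔ b)).mp ?_ h
                rw [compl_sup]
                exact F.inf_mem _ _ hab.1 hab.2
              map_inf' := fun a b => by
                ext F
                exact ⟨fun h => ⟨F.mono _ _ inf_le_left h, F.mono _ _ inf_le_right h⟩,
                  fun h => F.inf_mem _ _ h.1 h.2⟩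
              map_top' := by
                ext F
                exact ⟨fun _ => trivial, fun _ => F.top_mem⟩
              map_bot' := by
                ext F
                refine ⟨fun h => ?_, fun h => h.elim⟩
                refine (F.compl_mem_iff ⊥).mp ?_ h
                rw [compl_bot]
                exact F.top_mem }
          naturality := fun A B f => rfl }
      counit :=
        { app := fun X => Quiver.Hom.op (X := X.unop) (Y := UltrafilterBA (Set X.unop))
            (TypeCat.ofHom fun x =>
              { mem := fun Y => x ∈ Y
                top_mem := trivial
                inf_mem := fun _ _ h k => ⟨h, k⟩
                mono := fun _ _ h k => h k
                compl_mem_iff := fun _ => Iff.rfl })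
          naturality := fun X Y f => rfl }
      left_triangle := rfl
      right_triangle := rfl }

end Classical

/-! ### Abstract coalgebraic logics and expressivity -/

section AbstractLogic

variable {C : Type*} [Category* C] {V : Type*} [Category* V]

/-- An abstract coalgebraic logic for `T`, relative to a dual adjunction. -/
structure AbstractCoalgebraicLogic {S : V ⥤ Cᵒᵖ} {P : Cᵒᵖ ⥤ V} (adj : S ⊣ P) (T : C ⥤ C) where
  L : V ⥤ V
  δ : P ⋙ L ⟶ T.op ⋙ P

namespace AbstractCoalgebraicLogic

variable {S : V ⥤ Cᵒᵖ} {P : Cᵒᵖ ⥤ V} {adj : S ⊣ P} {T : C ⥤ C}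
  (Λ : AbstractCoalgebraicLogic adj T)

/-- The component at `A` of the adjoint transpose `T S ⟶ S P T S ⟶ S L P S ⟶ S L` of `δ`. -/
def transpose (A : V) : T.obj (S.obj A).unop ⟶ (S.obj (Λ.L.obj A)).unop :=
  (adj.counit.app (op (T.obj (S.obj A).unop))).unop ≫
    (S.map (Λ.δ.app (S.obj A))).unop ≫ (S.map (Λ.L.map (adj.unit.app A))).unop

/-- Expressivity with respect to a class `E` of epimorphisms and a class `M` of monomorphisms for
which every morphism factors as a member of `E` followed by a member of `M`. -/
structure IsExpressive (E M : MorphismProperty C) : Prop where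
  hasInitial : HasInitial (Endofunctor.Algebra Λ.L)
  epi : E ≤ MorphismProperty.epimorphisms C
  mono : M ≤ MorphismProperty.monomorphisms C
  hasFactorization : MorphismProperty.HasFactorization E M
  preserves : ∀ ⦃X Y : C⦄ (f : X ⟶ Y), M f → M (T.map f)
  transpose_mem : ∀ A : V, M (Λ.transpose A)

end AbstractCoalgebraicLogic

/-- The strong epimorphisms, that is, the epimorphisms which have the left lifting property with
respect to all monomorphisms. -/
def strongEpimorphisms (C : Type*) [Category* C] : MorphismProperty C := fun _ _ f => StrongEpi f

end AbstractLogic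

/-! ### Auxiliary diagram chases -/

section Aux

variable {C : Type*} [Category* C]

lemma aux_wedge {A X₁ X₂ X Y₁ Y₂ Y Z₁ Z₂ W : C} {π₁ : A ⟶ X₁} {π₂ : A ⟶ X₂} {p : X₁ ⟶ X}
    {k : X₂ ⟶ X} {a₁ : X₁ ⟶ Y₁} {a₂ : X₂ ⟶ Y₂} {a : X ⟶ Y} {q : Y₁ ⟶ Y} {r : Y₂ ⟶ Y}
    {t₁ : Y₁ ⟶ Z₁} {t₂ : Y₂ ⟶ Z₂} {t : Y ⟶ W} {v₁ : Z₁ ⟶ W} {v₂ : Z₂ ⟶ W}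
    (e₁ : π₁ ≫ p = π₂ ≫ k) (e₂ : a₁ ≫ q = p ≫ a) (e₃ : q ≫ t = t₁ ≫ v₁)
    (e₄ : k ≫ a = a₂ ≫ r) (e₅ : r ≫ t = t₂ ≫ v₂) :
    (π₁ ≫ a₁ ≫ t₁) ≫ v₁ = (π₂ ≫ a₂ ≫ t₂) ≫ v₂ := by
  simp only [Category.assoc]
  rw [← e₃, ← Category.assoc a₁, e₂, Category.assoc,
    ← Category.assoc, e₁, Category.assoc, ← Category.assoc k, e₄, Category.assoc, e₅]

lemma aux_natural {A A' X X' Y Y' Z Z' : C} {f : A' ⟶ A} {π : A ⟶ X} {π' : A' ⟶ X'} {k : X' ⟶ X}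
    {a : X ⟶ Y} {a' : X' ⟶ Y'} {r : Y' ⟶ Y} {t : Y ⟶ Z} {t' : Y' ⟶ Z'} {v : Z' ⟶ Z}
    (e₁ : f ≫ π = π' ≫ k) (e₂ : k ≫ a = a' ≫ r) (e₃ : r ≫ t = t' ≫ v) :
    f ≫ π ≫ a ≫ t = (π' ≫ a' ≫ t') ≫ v := by
  simp only [Category.assoc]
  rw [← Category.assoc, e₁, Category.assoc, ← Category.assoc k, e₂, Category.assoc, e₃]

lemma aux_square {A A' B B' W W' : C} {f : A' ⟶ A} {d : A ⟶ B} {d' : A' ⟶ B'} {g : B' ⟶ B}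
    {i : B ⟶ W} {i' : B' ⟶ W'} {j : W' ⟶ W} {w : A ⟶ W} {w' : A' ⟶ W'} (e₁ : d ≫ i = w)
    (e₂ : d' ≫ i' = w') (e₃ : f ≫ w = w' ≫ j) (e₄ : g ≫ i = i' ≫ j) :
    (f ≫ d) ≫ i = (d' ≫ g) ≫ i := by
  rw [Category.assoc, Category.assoc, e₁, e₄, e₃, ← e₂, Category.assoc]

variable {V : Type*} [Category* V] {F : V ⥤ C} {G : C ⥤ V} (adj : F ⊣ G)

lemma aux_transpose {A : V} {Y Z : C} (f : F.obj A ⟶ Y) (k : Y ⟶ Z) (g : A ⟶ G.obj Z)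
    (h : f ≫ k = (adj.homEquiv A Z).symm g) : adj.homEquiv A Y f ≫ G.map k = g := by
  rw [← Adjunction.homEquiv_naturality_right, h, Equiv.apply_symm_apply]

lemma aux_transpose_symm {A : V} {Y Y' Z : C} {f : A ⟶ G.obj Y} {f' : A ⟶ G.obj Y'} {k : Y ⟶ Z}
    {k' : Y' ⟶ Z} (h : f ≫ G.map k = f' ≫ G.map k') :
    (adj.homEquiv A Y).symm f ≫ k = (adj.homEquiv A Y').symm f' ≫ k' := by
  have e := congrArg (adj.homEquiv A Z).symm h
  rwa [Adjunction.homEquiv_naturality_right_symm, Adjunction.homEquiv_naturality_right_symm] at e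

end Aux

/-! ### The liftings of endofunctors and of classical coalgebraic logics -/

section Lifting

variable (Lang : FirstOrder.Language.{v, w}) [Lang.IsAlgebraic] (D : Type u) [Lang.Structure D]

/-- The diagram `(S, S') ↦ V^S T C^S' X`, functorially in `X`. -/
def diagramT (T : Type u ⥤ Type u) :
    SetD Lang D ⥤ (Lang.Substructure D)ᵒᵖ ⥤ Lang.Substructure D ⥤ SetD Lang D :=
  (functorC Lang D).flip ⋙
    (Functor.whiskeringRight _ _ _).obj (T ⋙ (functorV Lang D).flip) ⋙ flipFunctor _ _ _

/-- The lifting `T' X = ∫^S V^S T C^S X`. -/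
noncomputable def liftT (T : Type u ⥤ Type u) : SetD Lang D ⥤ SetD Lang D :=
  diagramT Lang D T ⋙ coendFunctor _ _

variable [Fintype D] [Nontrivial D] [Lattice D] [BoundedOrder D] [BoundedLatticeReduct Lang D]
  [IsSemiPrimal Lang D]

/-- The diagram `(S', S) ↦ P_S L K_S' A`, functorially in `A`. -/
noncomputable def diagramL (L : BoolAlg.{u} ⥤ BoolAlg.{u}) :
    Variety Lang D ⥤ (Lang.Substructure D)ᵒᵖ ⥤ Lang.Substructure D ⥤ Variety Lang D :=
  (functorK Lang D).flip ⋙ (Functor.whiskeringRight _ _ _).obj (L ⋙ (functorP Lang D).flip)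

/-- The lifting `L' A = ∫_S P_S L K_S A`. -/
noncomputable def liftL (L : BoolAlg.{u} ⥤ BoolAlg.{u}) : Variety Lang D ⥤ Variety Lang D :=
  diagramL Lang D L ⋙ endFunctor _ _

variable {Lang D}

lemma eq_top_or_eq_bot {A : Variety Lang D} (u : A.carrier →[Lang] D) (a : Skel A) :
    u a.val = ⊤ ∨ u a.val = ⊥ := by
  have h := congrArg u a.property
  rw [map_opT, opT_self] at h
  split_ifs at h
  · exact Or.inl h.symm
  · exact Or.inr h.symm

/-- A family of homomorphisms into `D` restricts to a homomorphism from the Boolean skeleton into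
a powerset algebra. -/
def skelToSet {A : Variety Lang D} {I : Type u} (u : I → (A.carrier →[Lang] D)) :
    BoundedLatticeHom (Skel A) (Set I) where
  toFun a := {i | u i a.val = ⊤}
  map_sup' a b := by
    ext i
    change u i (opSup Lang D a.val b.val) = ⊤ ↔ u i a.val = ⊤ ∨ u i b.val = ⊤
    rw [map_opSup, opSup_self]
    rcases eq_top_or_eq_bot (u i) a with h | h <;> rcases eq_top_or_eq_bot (u i) b with k | k <;>
      simp [h, k]
  map_inf' a b := by
    ext i
    change u i (opInf Lang D a.val b.val) = ⊤ ↔ u i a.val = ⊤ ∧ u i b.val = ⊤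
    rw [map_opInf, opInf_self]
    rcases eq_top_or_eq_bot (u i) a with h | h <;> rcases eq_top_or_eq_bot (u i) b with k | k <;>
      simp [h, k]
  map_top' := by
    ext i
    change u i (opTop Lang D) = ⊤ ↔ True
    simp [map_opTop, opTop_self]
  map_bot' := by
    ext i
    change u i (opBot Lang D) = ⊤ ↔ False
    simp [map_opBot, opBot_self]

/-- Evaluation at a point of `C^S X`, on the quotient of `P' X`. -/
def quotEv (S : Lang.Substructure D) (X : SetD Lang D) (x : {x : X.carrier // X.val x ≤ S}) :
    (quotObj S (prodObj X)).carrier →[Lang] D :=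
  mkHom (A := Quotient (congr S (prodObj X)))
    (Quotient.lift (ProdCarrier.ev X x.1)
      (fun a b h => h (ProdCarrier.ev X x.1) fun c => x.2 ((c : ProdCarrier X) x.1).2))
    (fun n g y => by
      obtain ⟨z, rfl⟩ : ∃ z : Fin n → ProdCarrier X,
          (fun i => Quotient.mk (congr S (prodObj X)) (z i)) = y :=
        ⟨fun i => (y i).out, funext fun i => Quotient.out_eq _⟩
      exact congrArg _ (FirstOrder.Language.funMap_quotient_mk' (congr S (prodObj X)) g z))

/-- The inverse of the natural isomorphism `Ψ^S : P C^S ≅ K_S P'`: the class of `α` is sent to the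
set of all `x` in `C^S X` with `α x = ⊤`. -/
noncomputable def psiInv (S : Lang.Substructure D) (X : SetD Lang D) :
    ((functorK Lang D).obj (op S)).obj ((functorP' Lang D).obj (op X)) ⟶
      functorPow.obj (op (((functorC Lang D).obj S).obj X)) :=
  BoolAlg.ofHom (X := Skel (quotObj S (prodObj X))) (Y := Set {x : X.carrier // X.val x ≤ S})
    (skelToSet (quotEv S X))

lemma BoolPower.exists_mem {S : Lang.Substructure D} {Y : Type u} (ξ : BoolPower S (Set Y))
    (y : Y) : ∃ d, y ∈ ξ.val d := by
  have h : y ∈ Finset.univ.sup ξ.val := by rw [ξ.sup_eq]; trivial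
  rw [Finset.sup_set_eq_biUnion] at h
  simpa using h

/-- The unique element of `S` whose component contains `y`. -/
noncomputable def BoolPower.value {S : Lang.Substructure D} {Y : Type u}
    (ξ : BoolPower S (Set Y)) (y : Y) : S :=
  ⟨(ξ.exists_mem y).choose, by
    by_contra h
    have := (ξ.exists_mem y).choose_spec
    rw [ξ.support _ h] at this
    exact this⟩

lemma BoolPower.value_eq_iff {S : Lang.Substructure D} {Y : Type u}
    (ξ : BoolPower S (Set Y)) (y : Y) (d : D) : (ξ.value y : D) = d ↔ y ∈ ξ.val d := by
  have h : y ∈ ξ.val (ξ.value y : D) := (ξ.exists_mem y).choose_spec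
  refine ⟨fun e => e ▸ h, fun k => ?_⟩
  by_contra e
  exact Set.disjoint_left.mp (ξ.disjoint _ _ e) h k

/-- The inverse of the natural isomorphism `Θ^S : P' V^S ≅ P_S P`, where `Θ^S α` is the family of
the sets `{y | α y = s}`. -/
noncomputable def thetaInv (S : Lang.Substructure D) (Y : Type u) :
    ((functorP Lang D).obj S).obj (functorPow.obj (op Y)) ⟶
      (functorP' Lang D).obj (op (((functorV Lang D).obj (op S)).obj Y)) :=
  ⟨mkHom (A := BoolPower S (Set Y))
    (B := ProdCarrier (((functorV Lang D).obj (op S)).obj Y))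
    (fun ξ y => ξ.value y)
    (fun n g x => funext fun y => Subtype.ext (by
      refine (BoolPower.value_eq_iff _ _ _).mpr ?_
      have h : ({y} : Set Y) ≤ BoolPower.cell x (fun i => ((x i).value y : D)) :=
        Finset.le_inf fun i _ => Set.singleton_subset_iff.mpr
          ((BoolPower.value_eq_iff (x i) y _).mp rfl)
      classical
      refine (h.trans ?_) (Set.mem_singleton y)
      exact Finset.le_sup (f := BoolPower.cell x)
        (Finset.mem_filter.mpr ⟨Finset.mem_univ _, rfl⟩)))⟩

variable {T : Type u ⥤ Type u} (Λ : AbstractCoalgebraicLogic adjClassical.{u} T)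

/-- The wedge `L' P' X ⟶ P_S L K_S P' X ⟶ P_S L P C^S X ⟶ P_S P T C^S X ⟶ P' V^S T C^S X`. -/
noncomputable def wedge (X : SetD Lang D) (S : Lang.Substructure D) :
    (liftL Lang D Λ.L).obj ((functorP' Lang D).obj (op X)) ⟶
      (functorP' Lang D).obj (op ((((diagramT Lang D T).obj X).obj (op S)).obj S)) :=
  end_.π ((diagramL Lang D Λ.L).obj ((functorP' Lang D).obj (op X))) S ≫
    ((functorP Lang D).obj S).map
      (Λ.L.map (psiInv S X) ≫ Λ.δ.app (op (((functorC Lang D).obj S).obj X))) ≫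
    thetaInv S (T.obj (((functorC Lang D).obj S).obj X))

lemma psiInv_naturality_left {S S' : Lang.Substructure D} (h : S ⟶ S') (X : SetD Lang D) :
    ((functorK Lang D).map h.op).app ((functorP' Lang D).obj (op X)) ≫ psiInv S X =
      psiInv S' X ≫ functorPow.map (((functorC Lang D).map h).app X).op := by
  refine BoolAlg.ext fun a => ?_
  obtain ⟨a, ha⟩ := a
  induction a using Quotient.ind
  rfl

lemma psiInv_naturality_right (S : Lang.Substructure D) {X Y : SetD Lang D} (f : X ⟶ Y) :
    ((functorK Lang D).obj (op S)).map ((functorP' Lang D).map f.op) ≫ psiInv S X =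
      psiInv S Y ≫ functorPow.map (((functorC Lang D).obj S).map f).op := by
  refine BoolAlg.ext fun a => ?_
  obtain ⟨a, ha⟩ := a
  induction a using Quotient.ind
  rfl

lemma thetaInv_naturality_left {S S' : Lang.Substructure D} (h : S ⟶ S') (Y : Type u) :
    ((functorP Lang D).map h).app (functorPow.obj (op Y)) ≫ thetaInv S' Y =
      thetaInv S Y ≫ (functorP' Lang D).map (((functorV Lang D).map h.op).app Y).op := by
  refine Variety.hom_ext fun ξ => funext fun y => Subtype.ext ?_
  refine (BoolPower.value_eq_iff _ _ _).mpr ?_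
  exact (BoolPower.value_eq_iff (S := S) (Y := Y) ξ y _).mp rfl

lemma thetaInv_naturality_right (S : Lang.Substructure D) {Y Z : Type u} (f : Y ⟶ Z) :
    ((functorP Lang D).obj S).map (functorPow.map f.op) ≫ thetaInv S Y =
      thetaInv S Z ≫ (functorP' Lang D).map (((functorV Lang D).obj (op S)).map f).op := by
  refine Variety.hom_ext fun ξ => funext fun y => Subtype.ext ?_
  refine (BoolPower.value_eq_iff _ _ _).mpr ?_
  exact (BoolPower.value_eq_iff (S := S) (Y := Z) ξ (f y) _).mp rfl

lemma wedge_condition (X : SetD Lang D) {S S' : Lang.Substructure D} (h : S ⟶ S') :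
    wedge Λ X S ≫ (functorP' Lang D).map
        ((((diagramT Lang D T).obj X).map h.op).app S).op =
      wedge Λ X S' ≫ (functorP' Lang D).map
        ((((diagramT Lang D T).obj X).obj (op S')).map h).op := by
  have e1 := end_.condition
    ((diagramL Lang D Λ.L).obj ((functorP' Lang D).obj (op X))) h
  have e2 := thetaInv_naturality_left h (T.obj (((functorC Lang D).obj S).obj X))
  have e3 := thetaInv_naturality_right S' (T.map (((functorC Lang D).map h).app X))
  have e4 := ((functorP Lang D).map h).naturality
    (Λ.L.map (psiInv S X) ≫ Λ.δ.app (op (((functorC Lang D).obj S).obj X)))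
  have e5 : Λ.L.map (((functorK Lang D).map h.op).app ((functorP' Lang D).obj (op X))) ≫
      Λ.L.map (psiInv S X) ≫ Λ.δ.app (op (((functorC Lang D).obj S).obj X)) =
      (Λ.L.map (psiInv S' X) ≫ Λ.δ.app (op (((functorC Lang D).obj S').obj X))) ≫
        functorPow.map (T.map (((functorC Lang D).map h).app X)).op := by
    have n := Λ.δ.naturality (((functorC Lang D).map h).app X).op
    have m := congrArg Λ.L.map (psiInv_naturality_left (Lang := Lang) (D := D) h X)
    rw [Λ.L.map_comp, Λ.L.map_comp] at m
    rw [← Category.assoc, m, Category.assoc, Category.assoc]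
    exact congrArg _ n
  have e6 := (Functor.map_comp ((functorP Lang D).obj S') _ _).symm.trans
    ((congrArg ((functorP Lang D).obj S').map e5).trans (Functor.map_comp _ _ _))
  exact aux_wedge e1 e4 e2 e6 e3

/-- The adjoint transpose of the wedge. -/
noncomputable def cowedge (X : SetD Lang D) (S : Lang.Substructure D) :
    (((diagramT Lang D T).obj X).obj (op S)).obj S ⟶
      homObj ((liftL Lang D Λ.L).obj ((functorP' Lang D).obj (op X))) :=
  (((adj' Lang D).homEquiv _ _).symm (wedge Λ X S)).unop

lemma cowedge_condition (X : SetD Lang D) ⦃S S' : Lang.Substructure D⦄ (h : S ⟶ S') :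
    (((diagramT Lang D T).obj X).map h.op).app S ≫ cowedge Λ X S =
      (((diagramT Lang D T).obj X).obj (op S')).map h ≫ cowedge Λ X S' :=
  Quiver.Hom.op_inj (aux_transpose_symm (adj' Lang D) (wedge_condition Λ X h))

/-- The lifting of `δ`: the morphism into `P' T' X` which is induced by the wedge. As `P'` is right
adjoint, it sends the coend `T' X` to an end; explicitly, the adjoint transposes of the wedge
form a cowedge with vertex `S' L' P' X`. -/
noncomputable def liftδApp (X : SetD Lang D) :
    (liftL Lang D Λ.L).obj ((functorP' Lang D).obj (op X)) ⟶
      (functorP' Lang D).obj (op ((liftT Lang D T).obj X)) :=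
  (adj' Lang D).homEquiv _ _ (Quiver.Hom.op
    (coend.desc (fun S => cowedge Λ X S) (cowedge_condition Λ X)))

/-- The defining property of the lifting of `δ`. -/
lemma liftδApp_comp (X : SetD Lang D) (S : Lang.Substructure D) :
    liftδApp Λ X ≫ (functorP' Lang D).map (coend.ι ((diagramT Lang D T).obj X) S).op =
      wedge Λ X S := by
  refine aux_transpose (adj' Lang D) _ (coend.ι ((diagramT Lang D T).obj X) S).op (wedge Λ X S) ?_
  exact Quiver.Hom.unop_inj (coend.ι_desc _ (cowedge_condition Λ X) S)

lemma functorP'_hom_ext {A : Variety Lang D} (X : SetD Lang D)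
    {f g : A ⟶ (functorP' Lang D).obj (op ((liftT Lang D T).obj X))}
    (h : ∀ S, f ≫ (functorP' Lang D).map (coend.ι ((diagramT Lang D T).obj X) S).op =
      g ≫ (functorP' Lang D).map (coend.ι ((diagramT Lang D T).obj X) S).op) : f = g := by
  apply ((adj' Lang D).homEquiv _ _).symm.injective
  apply Quiver.Hom.unop_inj
  exact coend.hom_ext fun S => Quiver.Hom.op_inj (aux_transpose_symm (adj' Lang D) (h S))

lemma wedge_naturality {X Y : SetD Lang D} (f : X ⟶ Y) (S : Lang.Substructure D) :
    (liftL Lang D Λ.L).map ((functorP' Lang D).map f.op) ≫ wedge Λ X S =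
      wedge Λ Y S ≫ (functorP' Lang D).map
        ((((diagramT Lang D T).map f).app (op S)).app S).op := by
  have e1 : (liftL Lang D Λ.L).map ((functorP' Lang D).map f.op) ≫
      end_.π ((diagramL Lang D Λ.L).obj ((functorP' Lang D).obj (op X))) S = _ :=
    end_.map_π ((diagramL Lang D Λ.L).map ((functorP' Lang D).map f.op)) S
  have e3 := thetaInv_naturality_right S (T.map (((functorC Lang D).obj S).map f))
  have e5 : Λ.L.map (((functorK Lang D).obj (op S)).map ((functorP' Lang D).map f.op)) ≫
      Λ.L.map (psiInv S X) ≫ Λ.δ.app (op (((functorC Lang D).obj S).obj X)) =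
      (Λ.L.map (psiInv S Y) ≫ Λ.δ.app (op (((functorC Lang D).obj S).obj Y))) ≫
        functorPow.map (T.map (((functorC Lang D).obj S).map f)).op := by
    have n := Λ.δ.naturality (((functorC Lang D).obj S).map f).op
    have m := congrArg Λ.L.map (psiInv_naturality_right (Lang := Lang) (D := D) S f)
    rw [Λ.L.map_comp, Λ.L.map_comp] at m
    rw [← Category.assoc, m, Category.assoc, Category.assoc]
    exact congrArg _ n
  have e6 := (Functor.map_comp ((functorP Lang D).obj S) _ _).symm.trans
    ((congrArg ((functorP Lang D).obj S).map e5).trans (Functor.map_comp _ _ _))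
  exact aux_natural e1 e6 e3

namespace AbstractCoalgebraicLogic

variable (Lang D) in
/-- The lifting `(L', δ')` of a classical coalgebraic logic `(L, δ)`. -/
noncomputable def lift : AbstractCoalgebraicLogic (adj' Lang D) (liftT Lang D T) where
  L := liftL Lang D Λ.L
  δ :=
    { app := fun X => liftδApp Λ X.unop
      naturality := fun X Y f => functorP'_hom_ext Y.unop fun S => by
        have e1 := wedge_naturality Λ f.unop S
        have e2 : coend.ι ((diagramT Lang D T).obj Y.unop) S ≫ (liftT Lang D T).map f.unop =
            (((diagramT Lang D T).map f.unop).app (op S)).app S ≫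
              coend.ι ((diagramT Lang D T).obj X.unop) S :=
          coend.ι_map ((diagramT Lang D T).map f.unop) S
        exact aux_square (liftδApp_comp Λ Y.unop S) (liftδApp_comp Λ X.unop S) e1
          (((functorP' Lang D).map_comp _ _).symm.trans
            ((congrArg (fun k => (functorP' Lang D).map k.op) e2).trans
              ((functorP' Lang D).map_comp _ _))) }

end AbstractCoalgebraicLogic

end Lifting

end MVLogic

/-!
The argument rests on two facts about the semi-primal algebra `D`. Throughout, `𝔖` is the Boolean
skeleton and `E` is the least subalgebra of `D`.

*Homomorphisms are ultrafilters.* For `A` in the variety, a homomorphism `A → D` is determined by the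
ultrafilter of all `a` in `𝔖 A` which it sends to `⊤`, and every ultrafilter `F` of `𝔖 A` arises: the
homomorphism sends `a` to the unique `d` with `T_d a ∈ F` (`homOfUltrafilter`). These homomorphisms
separate the points of `A` (`eq_of_forall_hom_eq`), so that statements about `A` can be verified in
`D`.

*Boolean powers of `E` are free.* The functor `B ↦ E[B]` is left adjoint to `𝔖`, with invertible unit
(`skeletonAdj`): as `E` is contained in all subalgebras, a term recovers an element of `E` from its
characteristic function, and by this term a Boolean homomorphism `B → 𝔖 A` extends to `E[B]`.

For the initial algebra, there is a natural comparison `E[L (𝔖 A)] ⟶ L' A` (`comparison`), which is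
invertible at `A = E[B]`, since there all the quotients `A / θ_S` agree with `A`. Consequently
homomorphisms of `L'`-algebras from `E[I]` correspond under the adjunction to homomorphisms of
`L`-algebras from `I`, and if `I` is initial, then so is `E[I]` (`hasInitial_algebra_of_adjunction`).

For the functor `T'`, the component of the coend at the largest subalgebra `D` is bijective on
underlying sets (`liftTι_bijective`), so `T' X` is `T X` with some valuation, and `T'` preserves
injections. For the adjoint transpose of `δ'`, a point of `T' S' A` is thus given by a point `t` of
`T (Hom (A, D))`, and `Hom (A, D)` embeds into the set of ultrafilters of `𝔖 A`. Evaluating the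
transpose at the elements of `L' A` which come from `L (𝔖 A)` along the comparison gives back the
adjoint transpose of `δ` at `𝔖 A` (`lift_transpose_ofBool`), which is injective.
-/

namespace MVLogic

/-! ### Ultrafilters of Boolean algebras -/

namespace UltrafilterBA

variable {B : Type u} [BooleanAlgebra B] (F : UltrafilterBA B)

lemma not_mem_bot : ¬ F.mem ⊥ := by
  rw [← F.compl_mem_iff, compl_bot]
  exact F.top_mem

lemma mem_sup_iff (a b : B) : F.mem (a ⊔ b) ↔ F.mem a ∨ F.mem b := by
  refine ⟨fun h => ?_, fun h => h.elim (F.mono _ _ le_sup_left) (F.mono _ _ le_sup_right)⟩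
  by_contra hab
  rw [not_or, ← F.compl_mem_iff, ← F.compl_mem_iff] at hab
  refine (F.compl_mem_iff (a ⊔ b)).mp ?_ h
  rw [compl_sup]
  exact F.inf_mem _ _ hab.1 hab.2

lemma mem_inf_iff (a b : B) : F.mem (a ⊓ b) ↔ F.mem a ∧ F.mem b :=
  ⟨fun h => ⟨F.mono _ _ inf_le_left h, F.mono _ _ inf_le_right h⟩,
    fun h => F.inf_mem _ _ h.1 h.2⟩

lemma mem_finset_sup_iff {ι : Type*} (s : Finset ι) (f : ι → B) :
    F.mem (s.sup f) ↔ ∃ i ∈ s, F.mem (f i) := by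
  classical
  induction s using Finset.induction_on with
  | empty => simp [F.not_mem_bot]
  | insert a s _ ih => simp [Finset.sup_insert, mem_sup_iff, ih]

lemma mem_finset_inf_iff {ι : Type*} (s : Finset ι) (f : ι → B) :
    F.mem (s.inf f) ↔ ∀ i ∈ s, F.mem (f i) := by
  classical
  induction s using Finset.induction_on with
  | empty => simp [F.top_mem]
  | insert a s _ ih => simp [Finset.inf_insert, mem_inf_iff, ih]

lemma exists_mem {a : B} (ha : a ≠ ⊥) : ∃ F : UltrafilterBA B, F.mem a := by
  have hd : Disjoint (Order.PFilter.principal a : Set B) (Order.Ideal.principal (⊥ : B) : Set B) :=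
    Set.disjoint_left.mpr fun b hb hb' => ha (le_bot_iff.mp
      (((Order.PFilter.mem_principal.mp hb).trans (Order.Ideal.mem_principal.mp hb'))))
  -- the complement of a prime ideal is an ultrafilter
  obtain ⟨J, hJ, -, hJd⟩ := DistribLattice.prime_ideal_of_disjoint_filter_ideal hd
  refine ⟨⟨fun b => b ∉ J, fun h => hJ.1.top_notMem h, fun b c hb hc h => ?_,
    fun b c hbc hb h => hb (J.lower hbc h), fun b => ?_⟩,
    Set.disjoint_left.mp hJd (Order.PFilter.mem_principal.mpr le_rfl)⟩
  · exact (hJ.mem_or_mem h).elim hb hc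
  · rw [not_not]
    refine ⟨fun h => hJ.mem_or_compl_mem.resolve_right h, fun h h' => ?_⟩
    exact hJ.1.top_notMem (by simpa using J.sup_mem h h')

lemma le_of_forall_mem {a b : B} (h : ∀ F : UltrafilterBA B, F.mem a → F.mem b) : a ≤ b := by
  by_contra hle
  have hne : a ⊓ bᶜ ≠ ⊥ := fun e => hle (by
    simpa using (disjoint_iff.mpr e).le_compl_right)
  obtain ⟨F, hF⟩ := exists_mem hne
  rw [F.mem_inf_iff, F.compl_mem_iff] at hF
  exact hF.2 (h F hF.1)

lemma eq_of_forall_mem_iff {a b : B} (h : ∀ F : UltrafilterBA B, F.mem a ↔ F.mem b) : a = b :=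
  le_antisymm (le_of_forall_mem fun F => (h F).mp) (le_of_forall_mem fun F => (h F).mpr)

end UltrafilterBA

lemma isIso_boolAlg_of_bijective {A B : BoolAlg.{u}} (f : A ⟶ B) (hf : Function.Bijective f) :
    IsIso f := by
  let e : A ≃o B :=
    { Equiv.ofBijective f hf with
      map_rel_iff' := fun {a b} => by
        change f a ≤ f b ↔ a ≤ b
        rw [← inf_eq_left, ← map_inf, hf.1.eq_iff, inf_eq_left] }
  have h : f = (BoolAlg.Iso.mk e).hom := BoolAlg.ext fun a => rfl
  rw [h]
  infer_instance

/-! ### The points of a Boolean power -/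

section BooleanPowerPoints

variable {Lang : FirstOrder.Language.{v, w}} [Lang.IsAlgebraic] {D : Type u} [Lang.Structure D]
  [Fintype D]

namespace BoolPower

variable {S : Lang.Substructure D} {B : Type u} [BooleanAlgebra B]

lemma existsUnique_mem (F : UltrafilterBA B) (ξ : BoolPower S B) : ∃! d, F.mem (ξ.val d) := by
  have h := F.top_mem
  rw [← ξ.sup_eq, F.mem_finset_sup_iff] at h
  obtain ⟨d, -, hd⟩ := h
  refine ⟨d, hd, fun e he => ?_⟩
  by_contra hne
  have := F.inf_mem _ _ he hd
  rw [(ξ.disjoint e d hne).eq_bot] at this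
  exact F.not_mem_bot this

/-- An ultrafilter `F` of `B` yields a homomorphism from the Boolean power to `D`, which sends `ξ`
to the index of the unique component which belongs to `F`. -/
noncomputable def point (S : Lang.Substructure D) (F : UltrafilterBA B) :
    BoolPower S B →[Lang] D :=
  mkHom (A := BoolPower S B) (fun ξ => (existsUnique_mem F ξ).choose) (fun n g x => by
    have h (ξ : BoolPower S B) : F.mem (ξ.val (existsUnique_mem F ξ).choose) :=
      (existsUnique_mem F ξ).choose_spec.1
    classical
    refine (existsUnique_mem F (funMap g x)).unique (h _) ?_
    refine (F.mem_finset_sup_iff _ _).mpr ⟨fun i => (existsUnique_mem F (x i)).choose, by simp, ?_⟩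
    exact (F.mem_finset_inf_iff _ _).mpr fun i _ => h (x i))

lemma point_eq_iff (F : UltrafilterBA B) (ξ : BoolPower S B) (d : D) :
    point S F ξ = d ↔ F.mem (ξ.val d) := by
  have h : F.mem (ξ.val (point S F ξ)) := (existsUnique_mem F ξ).choose_spec.1
  exact ⟨fun e => e ▸ h, fun k => (existsUnique_mem F ξ).unique h k⟩

lemma point_mem (F : UltrafilterBA B) (ξ : BoolPower S B) : point S F ξ ∈ S := by
  by_contra h
  have := (point_eq_iff F ξ _).mp rfl
  rw [ξ.support _ h] at this
  exact F.not_mem_bot this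

/-- The points of a Boolean power separate its elements. -/
lemma ext_point {ξ ζ : BoolPower S B} (h : ∀ F, point S F ξ = point S F ζ) : ξ = ζ :=
  BoolPower.ext (funext fun d => UltrafilterBA.eq_of_forall_mem_iff fun F => by
    rw [← point_eq_iff, ← point_eq_iff, h])

end BoolPower

end BooleanPowerPoints

/-! ### Homomorphisms into `D` as ultrafilters of the Boolean skeleton -/

section Points

variable {Lang : FirstOrder.Language.{v, w}} [Lang.IsAlgebraic] {D : Type u} [Lang.Structure D]
  [Fintype D] [Nontrivial D] [Lattice D] [BoundedOrder D] [BoundedLatticeReduct Lang D]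
  [IsSemiPrimal Lang D] {A : Variety Lang D}

open FirstOrder.Language.Term (var)

/-- Finite joins in the Boolean skeleton are given by terms. -/
lemma exists_term_sup {ι : Type*} {n : ℕ} (s : Finset ι) (t : ι → Lang.Term (Fin n)) :
    ∃ τ : Lang.Term (Fin n), (∀ x : Fin n → D, τ.realize x = s.sup fun i => (t i).realize x) ∧
      ∀ (x : Fin n → A.carrier) (b : ι → Skel A), (∀ i, (b i).val = (t i).realize x) →
        (s.sup b).val = τ.realize x := by
  classical
  induction s using Finset.induction_on with
  | empty =>
    exact ⟨tBot Lang D, fun x => by simp [realize_tBot, opBot_self],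
      fun x b _ => by rw [Finset.sup_empty, realize_tBot]; rfl⟩
  | insert i s _ ih =>
    obtain ⟨τ, h1, h2⟩ := ih
    refine ⟨tSup Lang D (t i) τ, fun x => ?_, fun x b hb => ?_⟩
    · rw [realize_tSup, opSup_self, h1, Finset.sup_insert]
    · rw [Finset.sup_insert, Skel.coe_sup, realize_tSup, hb, h2 x b hb]

/-- Finite meets in the Boolean skeleton are given by terms. -/
lemma exists_term_inf {ι : Type*} {n : ℕ} (s : Finset ι) (t : ι → Lang.Term (Fin n)) :
    ∃ τ : Lang.Term (Fin n), (∀ x : Fin n → D, τ.realize x = s.inf fun i => (t i).realize x) ∧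
      ∀ (x : Fin n → A.carrier) (b : ι → Skel A), (∀ i, (b i).val = (t i).realize x) →
        (s.inf b).val = τ.realize x := by
  classical
  induction s using Finset.induction_on with
  | empty =>
    exact ⟨tTop Lang D, fun x => by simp [realize_tTop, opTop_self],
      fun x b _ => by rw [Finset.inf_empty, realize_tTop]; rfl⟩
  | insert i s _ ih =>
    obtain ⟨τ, h1, h2⟩ := ih
    refine ⟨tInf Lang D (t i) τ, fun x => ?_, fun x b hb => ?_⟩
    · rw [realize_tInf, opInf_self, h1, Finset.inf_insert]
    · rw [Finset.inf_insert, Skel.coe_inf, realize_tInf, hb, h2 x b hb]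

namespace Skel

/-- `T_d a` as an element of the Boolean skeleton. -/
noncomputable def opT (d : D) (a : A.carrier) : Skel A where
  val := MVLogic.opT Lang D d a
  property := by
    have := A.sat 1 (tT Lang D ⊤ (tT Lang D d (var 0))) (tT Lang D d (var 0)) (fun x => by
      simp only [realize_tT, opT_self]
      by_cases h : x 0 = d <;> simp [h, bot_ne_top]) ![a]
    simpa [realize_tT] using this

lemma opT_val (d : D) (a : A.carrier) : (Skel.opT d a).val = MVLogic.opT Lang D d a := rfl

lemma sup_opT (a : A.carrier) : Finset.univ.sup (fun d => Skel.opT d a) = (⊤ : Skel A) := by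
  obtain ⟨τ, h1, h2⟩ := exists_term_sup (A := A) Finset.univ fun d : D => tT Lang D d (var (0 : Fin 1))
  refine Skel.ext ?_
  rw [h2 ![a] (fun d => Skel.opT d a) fun d => by rw [realize_tT]; rfl]
  refine (A.sat 1 τ (tTop Lang D) (fun x => ?_) ![a]).trans (realize_tTop Lang D _)
  rw [h1, realize_tTop, opTop_self]
  refine top_unique ?_
  refine le_trans ?_ (Finset.le_sup (Finset.mem_univ (x 0)))
  simp [realize_tT, opT_self]

lemma disjoint_opT {d e : D} (h : d ≠ e) (a : A.carrier) :
    Disjoint (Skel.opT d a) (Skel.opT e a : Skel A) := by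
  rw [disjoint_iff]
  refine Skel.ext ?_
  have := A.sat 1 (tInf Lang D (tT Lang D d (var 0)) (tT Lang D e (var 0))) (tBot Lang D)
    (fun x => by
      simp only [realize_tInf, realize_tT, realize_tBot, opBot_self, opInf_self, opT_self]
      by_cases h1 : x 0 = d
      · have : x 0 ≠ e := fun h' => h (h1.symm.trans h')
        simp [this]
      · simp [h1]) ![a]
  rw [realize_tInf, realize_tT, realize_tT, realize_tBot] at this
  exact this

/-- The operations of `A` are determined by the partitions of unity `d ↦ T_d a`. -/
lemma inf_opT_le {n : ℕ} (g : Lang.Functions n) (a : Fin n → A.carrier) (d : Fin n → D) :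
    Finset.univ.inf (fun i => Skel.opT (d i) (a i)) ≤ (Skel.opT (funMap g d) (funMap g a)) := by
  classical
  obtain ⟨τ, h1, h2⟩ := exists_term_inf (A := A) Finset.univ fun i : Fin n => tT Lang D (d i) (var i)
  rw [← sup_eq_right]
  refine Skel.ext ?_
  rw [coe_sup, h2 a (fun i => Skel.opT (d i) (a i)) fun d => by rw [realize_tT]; rfl]
  have := A.sat n (tSup Lang D τ (tT Lang D (funMap g d) (.func g var)))
    (tT Lang D (funMap g d) (.func g var)) (fun x => by
      simp only [realize_tSup, realize_tT, opSup_self, opT_self, FirstOrder.Language.Term.realize,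
        h1]
      by_cases h : ∀ i, x i = d i
      · obtain rfl : x = d := funext h
        simp
      · push Not at h
        obtain ⟨i, hi⟩ := h
        rw [sup_eq_right]
        refine (Finset.inf_le (Finset.mem_univ i)).trans ?_
        simp [hi]) a
  rw [realize_tSup, realize_tT] at this
  exact this

end Skel

lemma existsUnique_mem_opT (F : UltrafilterBA (Skel A)) (a : A.carrier) :
    ∃! d : D, F.mem (Skel.opT d a) := by
  have h := F.top_mem
  rw [← Skel.sup_opT a, F.mem_finset_sup_iff] at h
  obtain ⟨d, -, hd⟩ := h
  refine ⟨d, hd, fun e he => ?_⟩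
  by_contra hne
  have := F.inf_mem _ _ he hd
  rw [(Skel.disjoint_opT hne a).eq_bot] at this
  exact F.not_mem_bot this

/-- The homomorphism to `D` which corresponds to an ultrafilter `F` of the Boolean skeleton: it
sends `a` to the unique `d` with `T_d a ∈ F`. -/
noncomputable def homOfUltrafilter (F : UltrafilterBA (Skel A)) : A.carrier →[Lang] D :=
  mkHom (fun a => (existsUnique_mem_opT F a).choose) (fun n g x => by
    have h (a : A.carrier) : F.mem (Skel.opT (existsUnique_mem_opT F a).choose a) :=
      (existsUnique_mem_opT F a).choose_spec.1
    refine (existsUnique_mem_opT F (funMap g x)).unique (h _) ?_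
    refine F.mono _ _ (Skel.inf_opT_le g x _) ?_
    exact (F.mem_finset_inf_iff _ _).mpr fun i _ => h (x i))

lemma homOfUltrafilter_eq_iff (F : UltrafilterBA (Skel A)) (a : A.carrier) (d : D) :
    homOfUltrafilter F a = d ↔ F.mem (Skel.opT d a) := by
  have h : F.mem (Skel.opT (homOfUltrafilter F a) a) :=
    (existsUnique_mem_opT F a).choose_spec.1
  exact ⟨fun e => e ▸ h, fun k => (existsUnique_mem_opT F a).unique h k⟩

/-- The homomorphisms into `D` separate the elements of an algebra in the variety. If `a` and `b`
are not separated, then the join of all `T_d a ⊓ T_d b` belongs to every ultrafilter of the Boolean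
skeleton, so that it is `⊤`; and a term defining the discriminator-like operation
`(x, y, z) ↦ if z = ⊤ then x else y` shows that then `a = b`. -/
lemma eq_of_forall_hom_eq {a b : A.carrier} (h : ∀ u : A.carrier →[Lang] D, u a = u b) :
    a = b := by
  classical
  obtain ⟨τ, h1, h2⟩ := exists_term_sup (A := A) Finset.univ fun d : D =>
    tInf Lang D (tT Lang D d (var (0 : Fin 2))) (tT Lang D d (var 1))
  have ht : Finset.univ.sup (fun d : D => (Skel.opT d a ⊓ Skel.opT d b : Skel A)) = ⊤ := by
    refine UltrafilterBA.eq_of_forall_mem_iff fun F => ⟨fun _ => F.top_mem, fun _ => ?_⟩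
    rw [F.mem_finset_sup_iff]
    refine ⟨homOfUltrafilter F a, Finset.mem_univ _, F.inf_mem _ _ ?_ ?_⟩
    · rw [← homOfUltrafilter_eq_iff]
    · rw [← homOfUltrafilter_eq_iff, h]
  have hτ : τ.realize ![a, b] = opTop Lang D := by
    rw [← h2 ![a, b] (fun d => Skel.opT d a ⊓ Skel.opT d b) fun d => by
      rw [realize_tInf, realize_tT, realize_tT]; rfl, ht]
    rfl
  obtain ⟨s, hs⟩ := IsSemiPrimal.definable (Lang := Lang) (D := D) 3 (by norm_num)
    (fun x => if x 2 = ⊤ then x 0 else x 1) (fun S x hx => by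
      by_cases h2 : x 2 = ⊤
      · simpa only [if_pos h2] using hx 0
      · simpa only [if_neg h2] using hx 1)
  have e1 := A.sat 2 (s.subst ![var 0, var 1, τ]) (var 1) (fun x => by
    rw [FirstOrder.Language.Term.realize_subst, hs]
    by_cases hx : x 0 = x 1
    · simp [FirstOrder.Language.Term.realize, hx]
    · have : (Finset.univ.sup fun d : D => (tInf Lang D (tT Lang D d (var (0 : Fin 2)))
          (tT Lang D d (var 1))).realize x) = ⊥ := by
        refine bot_unique (Finset.sup_le fun d _ => ?_)
        rw [realize_tInf, realize_tT, realize_tT, opInf_self, opT_self, opT_self]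
        by_cases h0 : x 0 = d
        · have : x 1 ≠ d := fun h' => hx (h0.trans h'.symm)
          simp [FirstOrder.Language.Term.realize, this]
        · simp [FirstOrder.Language.Term.realize, h0]
      simp [FirstOrder.Language.Term.realize, h1, this, bot_ne_top]) ![a, b]
  have e2 := A.sat 2 (s.subst ![var 0, var 1, tTop Lang D]) (var 0) (fun x => by
    rw [FirstOrder.Language.Term.realize_subst, hs]
    simp [FirstOrder.Language.Term.realize, realize_tTop, opTop_self]) ![a, b]
  rw [FirstOrder.Language.Term.realize_subst] at e1 e2
  refine Eq.trans ?_ e1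
  refine e2.symm.trans (congrArg (fun y => s.realize y) (funext fun i => ?_))
  fin_cases i
  · rfl
  · rfl
  · change (tTop Lang D).realize ![a, b] = τ.realize ![a, b]
    rw [realize_tTop, hτ]

/-- A homomorphism into `D` is determined by its restriction to the Boolean skeleton. -/
lemma hom_ext_skel {u u' : A.carrier →[Lang] D}
    (h : ∀ a : Skel A, u a.val = ⊤ ↔ u' a.val = ⊤) : u = u' := by
  refine FirstOrder.Language.Hom.ext fun a => ?_
  have := (h (Skel.opT (u a) a)).mp (by
    rw [Skel.opT_val, map_opT, opT_self, if_pos rfl])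
  rw [Skel.opT_val, map_opT, opT_self] at this
  by_contra hne
  rw [if_neg (fun e => hne e.symm)] at this
  exact bot_ne_top this

/-- The ultrafilter of the elements of the Boolean skeleton at which a homomorphism has value `⊤`. -/
noncomputable def ultrafilterOfHom (u : A.carrier →[Lang] D) : UltrafilterBA (Skel A) :=
  UltrafilterBA.comap (skelToSet fun _ : PUnit => u)
    { mem := fun Y => PUnit.unit ∈ Y
      top_mem := trivial
      inf_mem := fun _ _ h k => ⟨h, k⟩
      mono := fun _ _ h k => h k
      compl_mem_iff := fun _ => Iff.rfl }

lemma ultrafilterOfHom_mem (u : A.carrier →[Lang] D) (a : Skel A) :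
    (ultrafilterOfHom u).mem a ↔ u a.val = ⊤ := Iff.rfl

end Points

/-! ### Boolean powers of the least subalgebra are left adjoint to the Boolean skeleton -/

section SkeletonAdjunction

variable {Lang : FirstOrder.Language.{v, w}} [Lang.IsAlgebraic] {D : Type u} [Lang.Structure D]
  [Fintype D] [Nontrivial D] [Lattice D] [BoundedOrder D] [BoundedLatticeReduct Lang D]
  [IsSemiPrimal Lang D]

namespace BoolPower

variable {B : Type u} [BooleanAlgebra B]

open Classical in
/-- An element `b` of `B`, as the element of the Boolean power with value `⊤` on `b` and value `⊥`
on the complement of `b`. -/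
noncomputable def ofBool (S : Lang.Substructure D) (b : B) : BoolPower S B where
  val d := if d = ⊤ then b else if d = ⊥ then bᶜ else ⊥
  disjoint d e h := by
    by_cases h1 : d = ⊤ <;> by_cases h2 : e = ⊤ <;> by_cases h3 : d = ⊥ <;>
      by_cases h4 : e = ⊥ <;> simp_all [disjoint_compl_right, disjoint_compl_left]
  sup_eq := by
    refine top_unique ?_
    rw [← sup_compl_eq_top (x := b)]
    refine sup_le ?_ ?_
    · refine le_trans ?_ (Finset.le_sup (Finset.mem_univ ⊤))
      simp
    · refine le_trans ?_ (Finset.le_sup (Finset.mem_univ ⊥))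
      simp [bot_ne_top]
  support d hd := by
    have h1 : d ≠ ⊤ := fun h => hd (h ▸ top_mem Lang S)
    have h2 : d ≠ ⊥ := fun h => hd (h ▸ bot_mem Lang S)
    simp [h1, h2]

lemma ofBool_val_top (S : Lang.Substructure D) (b : B) : (ofBool S b).val ⊤ = b := by
  simp [ofBool]

open Classical in
lemma point_ofBool (S : Lang.Substructure D) (F : UltrafilterBA B) (b : B) :
    point S F (ofBool S b) = if F.mem b then ⊤ else ⊥ := by
  rw [point_eq_iff]
  by_cases h : F.mem b
  · simp [ofBool, h]
  · simpa [ofBool, h, bot_ne_top] using (F.compl_mem_iff b).mpr h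

end BoolPower

open BoolPower

/-- The homomorphism from a Boolean algebra to the Boolean skeleton of its Boolean power. -/
noncomputable def toSkelPower (S : Lang.Substructure D) (B : BoolAlg.{u}) :
    B ⟶ (skeleton Lang D).obj (((functorP Lang D).obj S).obj B) :=
  BoolAlg.ofHom (X := B) (Y := Skel (obj S B))
    { toFun := fun b => ⟨ofBool S b, ext_point fun F => by
        classical
        refine (map_opT Lang D (point S F) ⊤ (ofBool S b)).trans ?_
        rw [point_ofBool, opT_self]
        split_ifs <;> simp_all⟩
      map_sup' := fun a b => Skel.ext (ext_point fun F => by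
        classical
        refine Eq.trans ?_ (map_opSup Lang D (point S F) (ofBool S a) (ofBool S b)).symm
        rw [opSup_self, point_ofBool, point_ofBool, point_ofBool, F.mem_sup_iff]
        split_ifs <;> simp_all)
      map_inf' := fun a b => Skel.ext (ext_point fun F => by
        classical
        refine Eq.trans ?_ (map_opInf Lang D (point S F) (ofBool S a) (ofBool S b)).symm
        rw [opInf_self, point_ofBool, point_ofBool, point_ofBool, F.mem_inf_iff]
        split_ifs <;> simp_all)
      map_top' := Skel.ext (ext_point fun F => by
        classical
        refine Eq.trans ?_ (map_opTop Lang D (point S F)).symm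
        rw [opTop_self, point_ofBool, if_pos F.top_mem])
      map_bot' := Skel.ext (ext_point fun F => by
        classical
        refine Eq.trans ?_ (map_opBot Lang D (point S F)).symm
        rw [opBot_self, point_ofBool, if_neg F.not_mem_bot]) }

lemma toSkelPower_val (S : Lang.Substructure D) (B : BoolAlg.{u}) (b : B) :
    Skel.val (toSkelPower S B b) = ofBool S b := rfl

lemma toSkelPower_bijective (S : Lang.Substructure D) (B : BoolAlg.{u}) :
    Function.Bijective (toSkelPower S B : B → Skel (obj S B)) := by
  classical
  refine ⟨fun a b h => ?_, fun ξ => ⟨BoolPower.val (Skel.val ξ) ⊤, Skel.ext (ext_point fun F => ?_)⟩⟩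
  · have := congrArg (fun ξ : Skel (obj S B) => BoolPower.val ξ.val ⊤) h
    simpa only [toSkelPower_val, ofBool_val_top] using this
  · rw [toSkelPower_val, point_ofBool]
    rcases eq_top_or_eq_bot (A := obj S B) (point S F) ξ with h | h
    · exact (if_pos ((point_eq_iff F _ _).mp h)).trans h.symm
    · exact (if_neg fun h' => bot_ne_top (h.symm.trans ((point_eq_iff F _ _).mpr h'))).trans h.symm

instance isIso_toSkelPower (S : Lang.Substructure D) (B : BoolAlg.{u}) : IsIso (toSkelPower S B) :=
  isIso_boolAlg_of_bijective _ (toSkelPower_bijective S B)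

section Extend

variable {A : Variety Lang D} {B : Type u} [BooleanAlgebra B]
  (g : BoundedLatticeHom B (Skel A))

variable (Lang D) in
/-- The operation which recovers an element of the least subalgebra from its characteristic
function is term-definable, as the least subalgebra is contained in all others. -/
lemma exists_term_least : ∃ t : Lang.Term (Fin (Fintype.card D)),
    ∀ (x : Fin (Fintype.card D) → D) (d : D), d ∈ (⊥ : Lang.Substructure D) →
      (∀ e, x (Fintype.equivFin D e) = ⊤ ↔ e = d) → t.realize x = d := by
  classical
  obtain ⟨t, ht⟩ := IsSemiPrimal.definable (Lang := Lang) (D := D) (Fintype.card D)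
    Fintype.card_pos (fun x => if h : ∃ d ∈ (⊥ : Lang.Substructure D),
      ∀ e, x (Fintype.equivFin D e) = ⊤ ↔ e = d then h.choose else ⊥) (fun S x _ => by
    by_cases h : ∃ d ∈ (⊥ : Lang.Substructure D), ∀ e, x (Fintype.equivFin D e) = ⊤ ↔ e = d
    · simpa only [dif_pos h] using (bot_le : ⊥ ≤ S) h.choose_spec.1
    · simpa only [dif_neg h] using bot_mem Lang S)
  refine ⟨t, fun x d hd hx => ?_⟩
  have h : ∃ d ∈ (⊥ : Lang.Substructure D), ∀ e, x (Fintype.equivFin D e) = ⊤ ↔ e = d :=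
    ⟨d, hd, hx⟩
  rw [ht, dif_pos h]
  exact (hx _).mp ((h.choose_spec.2 _).mpr rfl)

/-- The underlying map of the extension of a Boolean homomorphism into the skeleton of `A` to a
homomorphism on the Boolean power of the least subalgebra. -/
noncomputable def extendFun (ξ : BoolPower (⊥ : Lang.Substructure D) B) : A.carrier :=
  (exists_term_least Lang D).choose.realize
    fun i => (g (ξ.val ((Fintype.equivFin D).symm i))).val

lemma hom_extendFun (ξ : BoolPower (⊥ : Lang.Substructure D) B) (u : A.carrier →[Lang] D) :
    u (extendFun g ξ) = point ⊥ ((ultrafilterOfHom u).comap g) ξ := by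
  rw [extendFun, ← FirstOrder.Language.HomClass.realize_term]
  refine (exists_term_least Lang D).choose_spec _ _ (point_mem _ ξ) fun e => ?_
  rw [eq_comm (a := e), point_eq_iff]
  simp only [Function.comp_apply, Equiv.symm_apply_apply]
  exact (ultrafilterOfHom_mem u _).symm

/-- The extension of a Boolean homomorphism into the skeleton of `A` to a homomorphism on the
Boolean power of the least subalgebra. -/
noncomputable def extend : obj (⊥ : Lang.Substructure D) B ⟶ A :=
  ⟨mkHom (A := BoolPower (⊥ : Lang.Substructure D) B) (extendFun g) (fun n o x =>
    eq_of_forall_hom_eq fun u => by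
      rw [hom_extendFun, FirstOrder.Language.Hom.map_fun]
      refine (FirstOrder.Language.Hom.map_fun (point ⊥ ((ultrafilterOfHom u).comap g)) o x).trans ?_
      exact congrArg _ (funext fun i => (hom_extendFun g (x i) u).symm))⟩

lemma extend_ofBool (b : B) : (extend g).hom (ofBool ⊥ b) = (g b).val :=
  eq_of_forall_hom_eq fun u => by
    classical
    refine (hom_extendFun g _ u).trans ?_
    rw [point_ofBool]
    change (if u (g b).val = ⊤ then ⊤ else ⊥) = _
    rcases eq_top_or_eq_bot u (g b) with h | h <;> simp [h, bot_ne_top]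

lemma hom_ext_ofBool {S : Lang.Substructure D} {f f' : obj S B ⟶ A}
    (h : ∀ b : B, f.hom (ofBool S b) = f'.hom (ofBool S b)) : f = f' :=
  Variety.hom_ext fun ξ => eq_of_forall_hom_eq fun u => by
    have e : u.comp f.hom = u.comp f'.hom := hom_ext_skel (A := obj S B) fun a => by
      obtain ⟨b, rfl⟩ := (toSkelPower_bijective S (BoolAlg.of B)).2 a
      change u (f.hom (ofBool S b)) = ⊤ ↔ u (f'.hom (ofBool S b)) = ⊤
      rw [h]
    exact DFunLike.congr_fun e ξ

end Extend

variable (Lang D) in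
/-- The Boolean power of the least subalgebra of `D` is left adjoint to the Boolean skeleton. -/
noncomputable def skeletonAdj : (functorP Lang D).obj ⊥ ⊣ skeleton Lang D :=
  Adjunction.mkOfHomEquiv
    { homEquiv := fun B A =>
        { toFun := fun f => toSkelPower ⊥ B ≫ (skeleton Lang D).map f
          invFun := fun g => extend (A := A) (B := B) g.hom
          left_inv := fun f => hom_ext_ofBool fun b => extend_ofBool _ b
          right_inv := fun g => BoolAlg.ext fun b => Skel.ext (extend_ofBool g.hom b) }
      homEquiv_naturality_left_symm := fun {B' B A} h g => hom_ext_ofBool fun b => by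
        refine (extend_ofBool (A := A) _ b).trans ?_
        refine (extend_ofBool (A := A) g.hom (h b)).symm.trans ?_
        refine congrArg (extend (A := A) (B := B) g.hom).hom ?_
        classical
        refine ext_point fun F => ?_
        rw [point_ofBool]
        refine (point_ofBool (Lang := Lang) (D := D) ⊥ (UltrafilterBA.comap h.hom F) b).symm.trans ?_
        rw [point_eq_iff]
        exact (point_eq_iff F ((((functorP Lang D).obj ⊥).map h).hom (ofBool ⊥ b)) _).mp rfl
      homEquiv_naturality_right := fun f k => (congrArg (toSkelPower ⊥ _ ≫ ·)
        (Functor.map_comp _ f k)).trans (Category.assoc _ _ _).symm }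

lemma skeletonAdj_unit_app (B : BoolAlg.{u}) :
    (skeletonAdj Lang D).unit.app B = toSkelPower ⊥ B := by
  simp only [skeletonAdj, Adjunction.mkOfHomEquiv_unit_app]
  change toSkelPower ⊥ B ≫ (skeleton Lang D).map (𝟙 _) = _
  rw [CategoryTheory.Functor.map_id, Category.comp_id]

instance (B : BoolAlg.{u}) : IsIso ((skeletonAdj Lang D).unit.app B) := by
  rw [skeletonAdj_unit_app]
  exact isIso_toSkelPower ⊥ B

end SkeletonAdjunction

/-! ### Initial algebras along an adjunction -/

section InitialAlgebra

variable {B : Type*} [Category* B] {A : Type*} [Category* A] {F : B ⥤ A} {G : A ⥤ B}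

/-- Let `F` be left adjoint to `G`, and let `φ : F L G ⟶ L'`. Then every `L'`-algebra `a` restricts
to an `L`-algebra on `G a`. If the composites `F L b ⟶ F L G F b ⟶ L' F b` are invertible and
`I` is an initial `L`-algebra, then `F I` is an initial `L'`-algebra: under the adjunction, the
`L'`-algebra homomorphisms `F I ⟶ a` correspond to the `L`-algebra homomorphisms `I ⟶ G a`. -/
lemma hasInitial_algebra_of_adjunction (adj : F ⊣ G) {L : B ⥤ B} {L' : A ⥤ A}
    (φ : G ⋙ L ⋙ F ⟶ L')
    (hφ : ∀ b : B, IsIso (F.map (L.map (adj.unit.app b)) ≫ φ.app (F.obj b)))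
    [HasInitial (Endofunctor.Algebra L)] : HasInitial (Endofunctor.Algebra L') := by
  let I : Endofunctor.Algebra L := ⊥_ (Endofunctor.Algebra L)
  obtain ⟨ψ, hψ⟩ : ∃ ψ, ψ = F.map (L.map (adj.unit.app I.a)) ≫ φ.app (F.obj I.a) := ⟨_, rfl⟩
  have : IsIso ψ := hψ ▸ hφ I.a
  let J : Endofunctor.Algebra L' := ⟨F.obj I.a, inv ψ ≫ F.map I.str⟩
  let res (a : Endofunctor.Algebra L') : Endofunctor.Algebra L :=
    ⟨G.obj a.a, adj.homEquiv _ _ (φ.app a.a ≫ a.str)⟩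
  have key (a : Endofunctor.Algebra L') (f : F.obj I.a ⟶ a.a) :
      L'.map f ≫ a.str = J.str ≫ f ↔
        L.map (adj.homEquiv _ _ f) ≫ (res a).str = I.str ≫ adj.homEquiv _ _ f := by
    have h1 : ψ ≫ L'.map f = F.map (L.map (adj.homEquiv _ _ f)) ≫ φ.app a.a := by
      have := φ.naturality f
      rw [hψ, Adjunction.homEquiv_unit, Functor.map_comp, Functor.map_comp, Category.assoc]
      rw [Category.assoc, ← this]
      rfl
    rw [← cancel_epi ψ, ← Category.assoc, h1]
    dsimp only [J, res]
    rw [Category.assoc, Category.assoc, IsIso.hom_inv_id_assoc, ← Adjunction.homEquiv_naturality_left,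
      ← Adjunction.homEquiv_naturality_left]
    exact (Equiv.apply_eq_iff_eq _).symm
  refine IsInitial.hasInitial (X := J) (IsInitial.ofUniqueHom (fun a =>
    ⟨(adj.homEquiv _ _).symm (initial.to (res a)).f, (key a _).mpr ?_⟩) fun a m => ?_)
  · rw [Equiv.apply_symm_apply]
    exact (initial.to (res a)).h
  · refine Endofunctor.Algebra.ext ?_
    dsimp only
    rw [Equiv.eq_symm_apply]
    let m' : I ⟶ res a := ⟨adj.homEquiv _ _ m.f, (key a m.f).mp m.h⟩
    exact congrArg Endofunctor.Algebra.Hom.f (initialIsInitial.hom_ext m' (initial.to (res a)))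

end InitialAlgebra

/-! ### The initial algebra of the lifting of `L` -/

section LiftingInitial

variable {Lang : FirstOrder.Language.{v, w}} [Lang.IsAlgebraic] {D : Type u} [Lang.Structure D]
  [Fintype D] [Nontrivial D] [Lattice D] [BoundedOrder D] [BoundedLatticeReduct Lang D]
  [IsSemiPrimal Lang D]

/-- The quotient map `A ⟶ A / θ_S`. -/
def toQuot (S : Lang.Substructure D) (A : Variety Lang D) : A ⟶ quotObj S A :=
  ⟨mkHom (B := Quotient (congr S A)) (Quotient.mk (congr S A)) fun _ g x =>
    (FirstOrder.Language.funMap_quotient_mk' (congr S A) g x).symm⟩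

/-- The quotient map on Boolean skeletons. -/
noncomputable def skelToK (S : Lang.Substructure D) (A : Variety Lang D) :
    (skeleton Lang D).obj A ⟶ ((functorK Lang D).obj (op S)).obj A :=
  (skeleton Lang D).map (toQuot S A)

lemma skelToK_comp {S S' : Lang.Substructure D} (h : S ⟶ S') (A : Variety Lang D) :
    skelToK S' A ≫ ((functorK Lang D).map h.op).app A = skelToK S A := rfl

lemma skelToK_naturality (S : Lang.Substructure D) {A A' : Variety Lang D} (f : A ⟶ A') :
    skelToK S A ≫ ((functorK Lang D).obj (op S)).map f = (skeleton Lang D).map f ≫ skelToK S A' :=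
  rfl

variable (L : BoolAlg.{u} ⥤ BoolAlg.{u})

/-- The projection `L' A ⟶ S[L (K_S A)]` of the end. -/
noncomputable def liftLπ (A : Variety Lang D) (S : Lang.Substructure D) :
    (liftL Lang D L).obj A ⟶
      ((functorP Lang D).obj S).obj (L.obj (((functorK Lang D).obj (op S)).obj A)) :=
  end_.π ((diagramL Lang D L).obj A) S

variable {L} in
lemma liftL_hom_ext {A A' : Variety Lang D} {f g : A' ⟶ (liftL Lang D L).obj A}
    (h : ∀ S, f ≫ liftLπ L A S = g ≫ liftLπ L A S) : f = g :=
  end_.hom_ext h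

lemma liftLπ_condition (A : Variety Lang D) {S S' : Lang.Substructure D} (h : S ⟶ S') :
    liftLπ L A S ≫ ((functorP Lang D).map h).app _ =
      liftLπ L A S' ≫ ((functorP Lang D).obj S').map
        (L.map (((functorK Lang D).map h.op).app A)) :=
  end_.condition ((diagramL Lang D L).obj A) h

lemma liftL_map_comp_π {A A' : Variety Lang D} (f : A ⟶ A') (S : Lang.Substructure D) :
    (liftL Lang D L).map f ≫ liftLπ L A' S =
      liftLπ L A S ≫ ((functorP Lang D).obj S).map
        (L.map (((functorK Lang D).obj (op S)).map f)) :=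
  end_.map_π ((diagramL Lang D L).map f) S

/-- The component `E[L (𝔖 A)] ⟶ S[L (𝔖 A)] ⟶ S[L (K_S A)]`, where `E` is the least subalgebra. -/
noncomputable def comparisonComponent (A : Variety Lang D) (S : Lang.Substructure D) :
    ((functorP Lang D).obj ⊥).obj (L.obj ((skeleton Lang D).obj A)) ⟶
      ((functorP Lang D).obj S).obj (L.obj (((functorK Lang D).obj (op S)).obj A)) :=
  ((functorP Lang D).map (homOfLE bot_le)).app _ ≫ ((functorP Lang D).obj S).map (L.map (skelToK S A))

lemma comparisonComponent_condition (A : Variety Lang D) {S S' : Lang.Substructure D} (h : S ⟶ S') :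
    comparisonComponent L A S ≫ ((functorP Lang D).map h).app _ =
      comparisonComponent L A S' ≫ ((functorP Lang D).obj S').map
        (L.map (((functorK Lang D).map h.op).app A)) := by
  have e : L.map (skelToK S A) = L.map (skelToK S' A) ≫
      L.map (((functorK Lang D).map h.op).app A) := by
    rw [← L.map_comp, skelToK_comp]
  exact Variety.hom_ext fun ξ => BoolPower.ext (funext fun d =>
    ConcreteCategory.congr_hom e (BoolPower.val ξ d))

/-- The component at `A` of the comparison of `L` and its lifting. -/
noncomputable def comparisonApp (A : Variety Lang D) :
    ((functorP Lang D).obj ⊥).obj (L.obj ((skeleton Lang D).obj A)) ⟶ (liftL Lang D L).obj A :=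
  end_.lift (F := (diagramL Lang D L).obj A) (comparisonComponent L A)
    fun _ _ h => comparisonComponent_condition L A h

lemma comparisonApp_comp_π (A : Variety Lang D) (S : Lang.Substructure D) :
    comparisonApp L A ≫ liftLπ L A S = comparisonComponent L A S :=
  end_.lift_π _ _ S

/-- The comparison `E[L (𝔖 A)] ⟶ L' A`, where `E` is the least subalgebra of `D`. -/
noncomputable def comparison :
    skeleton Lang D ⋙ L ⋙ (functorP Lang D).obj ⊥ ⟶ liftL Lang D L where
  app A := comparisonApp L A
  naturality A A' f := by
    refine liftL_hom_ext fun S => ?_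
    have e : L.map (skelToK S A) ≫ L.map (((functorK Lang D).obj (op S)).map f) =
        L.map ((skeleton Lang D).map f) ≫ L.map (skelToK S A') := by
      rw [← L.map_comp, skelToK_naturality, L.map_comp]
    rw [Category.assoc, Category.assoc, comparisonApp_comp_π, liftL_map_comp_π, ← Category.assoc,
      comparisonApp_comp_π]
    exact Variety.hom_ext fun ξ => BoolPower.ext (funext fun d =>
      (ConcreteCategory.congr_hom e (BoolPower.val ξ d)).symm)

/-- All quotients `E[B] / θ_S` of a Boolean power of the least subalgebra are trivial, as the
points of `E[B]` have images in `E`. -/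
lemma isIso_skelToK (S : Lang.Substructure D) (B : BoolAlg.{u}) :
    IsIso (skelToK S (BoolPower.obj (⊥ : Lang.Substructure D) B)) := by
  have hinj : ∀ ξ ζ : BoolPower (⊥ : Lang.Substructure D) B,
      Quotient.mk (congr S (BoolPower.obj ⊥ B)) ξ = Quotient.mk (congr S (BoolPower.obj ⊥ B)) ζ →
        ξ = ζ := fun ξ ζ h => BoolPower.ext_point fun F =>
    (Quotient.exact h) (BoolPower.point ⊥ F)
      fun c => (bot_le : ⊥ ≤ S) (BoolPower.point_mem F c)
  refine isIso_boolAlg_of_bijective _ ⟨fun a b h => Skel.ext (hinj _ _ (congrArg Skel.val h)),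
    fun b => ?_⟩
  obtain ⟨b, hb⟩ := b
  induction b using Quotient.ind with
  | _ ξ =>
  refine ⟨⟨ξ, hinj _ _ ?_⟩, rfl⟩
  exact (map_opT Lang D (toQuot S (BoolPower.obj ⊥ B)).hom ⊤ ξ).trans hb

lemma isIso_comparison (B : BoolAlg.{u}) :
    IsIso (((functorP Lang D).obj ⊥).map (L.map ((skeletonAdj Lang D).unit.app B)) ≫
      (comparison L).app (((functorP Lang D).obj ⊥).obj B)) := by
  have hK (S : Lang.Substructure D) :
      IsIso (skelToK S (((functorP Lang D).obj (⊥ : Lang.Substructure D)).obj B)) := isIso_skelToK S B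
  let A := ((functorP Lang D).obj (⊥ : Lang.Substructure D)).obj B
  -- for `A = E[B]`, all the algebras `K_S A` are isomorphic to `B`
  let k (S : Lang.Substructure D) : B ⟶ ((functorK Lang D).obj (op S)).obj A :=
    (skeletonAdj Lang D).unit.app B ≫ skelToK S A
  have hk (S : Lang.Substructure D) : IsIso (k S) := inferInstance
  have hkS (S : Lang.Substructure D) :
      ((functorK Lang D).map (homOfLE (bot_le : ⊥ ≤ S)).op).app A ≫ inv (k ⊥) ≫ k S = 𝟙 _ := by
    rw [← cancel_epi (k S), Category.comp_id]
    have : k S ≫ ((functorK Lang D).map (homOfLE (bot_le : ⊥ ≤ S)).op).app A = k ⊥ := by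
      rw [Category.assoc, skelToK_comp]
    rw [reassoc_of% this, IsIso.hom_inv_id_assoc]
  have hψ (S : Lang.Substructure D) (ξ) (d : D) : BoolPower.val (((((functorP Lang D).obj ⊥).map
      (L.map ((skeletonAdj Lang D).unit.app B)) ≫ (comparison L).app A) ≫
        liftLπ L A S).hom ξ) d = L.map (k S) (BoolPower.val ξ d) := by
    have e := congrArg (((functorP Lang D).obj ⊥).map (L.map ((skeletonAdj Lang D).unit.app B)) ≫ ·)
      (comparisonApp_comp_π L A S)
    have e' := (Category.assoc _ _ _).trans e
    refine (congrArg (fun f => BoolPower.val (Variety.Hom.hom f ξ) d) e').trans ?_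
    exact (ConcreteCategory.congr_hom (L.map_comp ((skeletonAdj Lang D).unit.app B) (skelToK S A))
      (BoolPower.val ξ d)).symm
  refine ⟨liftLπ L A ⊥ ≫ ((functorP Lang D).obj ⊥).map (L.map (inv (k ⊥))),
    ?_, ?_⟩
  · refine Variety.hom_ext fun ξ => BoolPower.ext (funext fun d => ?_)
    have e : L.map (k ⊥) ≫ L.map (inv (k ⊥)) = 𝟙 _ := by
      rw [← L.map_comp, IsIso.hom_inv_id, CategoryTheory.Functor.map_id]
    refine Eq.trans ?_ (ConcreteCategory.congr_hom e (BoolPower.val ξ d))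
    exact congrArg (L.map (inv (k ⊥))) (hψ ⊥ ξ d)
  -- the wedge condition for `E ≤ S` recovers the component at `S` from the one at `E`
  · refine liftL_hom_ext fun S => Variety.hom_ext fun x => BoolPower.ext (funext fun d => ?_)
    have e1 := congrArg (fun f => BoolPower.val (Variety.Hom.hom f x) d)
      (liftLπ_condition L A (homOfLE (bot_le : ⊥ ≤ S)))
    have e2 : L.map (((functorK Lang D).map (homOfLE (bot_le : ⊥ ≤ S)).op).app A) ≫
        L.map (inv (k ⊥)) ≫ L.map (k S) = 𝟙 _ := by
      rw [← L.map_comp, ← L.map_comp, hkS, CategoryTheory.Functor.map_id]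
    refine (hψ S ((liftLπ L A ⊥ ≫
      ((functorP Lang D).obj ⊥).map (L.map (inv (k ⊥)))).hom x) d).trans ?_
    refine (congrArg (fun b => L.map (k S) (L.map (inv (k ⊥)) b)) e1).trans ?_
    exact ConcreteCategory.congr_hom e2 (BoolPower.val
      ((liftLπ L A S).hom x) d)

/-- If `L` has an initial algebra `I`, then the Boolean power `E[I]` is an initial algebra of the
lifting of `L`. -/
lemma hasInitial_algebra_liftL [HasInitial (Endofunctor.Algebra L)] :
    HasInitial (Endofunctor.Algebra (liftL Lang D L)) :=
  hasInitial_algebra_of_adjunction (skeletonAdj Lang D) (comparison L) (isIso_comparison L)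

end LiftingInitial

/-! ### Monomorphisms and strong epimorphisms of `Set_D` -/

section SetDMono

variable {Lang : FirstOrder.Language.{v, w}} {D : Type u} [Lang.Structure D]

namespace SetD

variable {X Y : SetD Lang D}

lemma mono_iff_injective (f : X ⟶ Y) : Mono f ↔ Function.Injective f.toFun := by
  refine ⟨fun _ x y h => ?_, fun h => ⟨fun a b e => hom_ext fun z => h ?_⟩⟩
  · let pt (x : X.carrier) : (⟨PUnit, fun _ => ⊤⟩ : SetD Lang D) ⟶ X := ⟨fun _ => x, fun _ => le_top⟩
    have e : pt x = pt y := (cancel_mono f).mp (hom_ext fun _ => h)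
    exact congrFun (congrArg Hom.toFun e) PUnit.unit
  · exact congrFun (congrArg Hom.toFun e) z

lemma surjective_of_epi (f : X ⟶ Y) [Epi f] : Function.Surjective f.toFun := by
  intro y
  let p : Y ⟶ ⟨ULift Prop, fun _ => ⊥⟩ := ⟨fun _ => ⟨True⟩, fun _ => bot_le⟩
  let q : Y ⟶ ⟨ULift Prop, fun _ => ⊥⟩ := ⟨fun y => ⟨∃ x, f.toFun x = y⟩, fun _ => bot_le⟩
  have e : p = q := (cancel_epi f).mp (hom_ext fun x =>
    ULift.ext _ _ (propext ⟨fun _ => ⟨x, rfl⟩, fun _ => trivial⟩))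
  have := congrArg ULift.down (congrFun (congrArg Hom.toFun e) y)
  exact this.mp trivial

/-- A surjection is a strong epimorphism if the valuation of its codomain is the largest one for
which it is a morphism. -/
lemma strongEpi_of_surjective (f : X ⟶ Y) (hf : Function.Surjective f.toFun)
    (hv : ∀ y, ⨅ (x : X.carrier) (_ : f.toFun x = y), X.val x ≤ Y.val y) : StrongEpi f where
  epi := ⟨fun a b e => hom_ext fun y => by
    obtain ⟨x, rfl⟩ := hf y
    exact congrFun (congrArg Hom.toFun e) x⟩
  llp {Z W} z hz := ⟨fun {a b} sq => by
    have hz := (mono_iff_injective z).mp hz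
    have hw (x : X.carrier) : z.toFun (a.toFun x) = b.toFun (f.toFun x) :=
      congrFun (congrArg Hom.toFun sq.w) x
    have hs (x : X.carrier) : a.toFun (hf (f.toFun x)).choose = a.toFun x :=
      hz (by rw [hw, hw, (hf (f.toFun x)).choose_spec])
    -- the diagonal filler; its value does not depend on the chosen preimages, by `hs`
    let l : Y ⟶ Z := ⟨fun y => a.toFun (hf y).choose, fun y => by
      refine le_trans (le_iInf fun x => le_iInf fun h => ?_) (hv y)
      subst h
      rw [hs]
      exact a.val_le x⟩
    exact ⟨⟨⟨l, hom_ext hs, hom_ext fun y => (hw _).trans (congrArg _ (hf y).choose_spec)⟩⟩⟩⟩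

instance hasFactorization : MorphismProperty.HasFactorization (strongEpimorphisms (SetD Lang D))
    (MorphismProperty.monomorphisms (SetD Lang D)) where
  nonempty_mapFactorizationData {X Y} f := by
    let I : SetD Lang D := ⟨Set.range f.toFun, fun y => ⨅ (x : X.carrier) (_ : f.toFun x = y), X.val x⟩
    let e : X ⟶ I := ⟨fun x => ⟨f.toFun x, x, rfl⟩, fun x => iInf_le_of_le x (iInf_le_of_le rfl le_rfl)⟩
    let m : I ⟶ Y := ⟨fun y => y.1, fun y => le_iInf fun x => le_iInf fun h => h ▸ f.val_le x⟩
    have he : StrongEpi e := strongEpi_of_surjective e (fun ⟨_, x, hx⟩ => ⟨x, Subtype.ext hx⟩)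
      fun y => le_iInf fun x => le_iInf fun h =>
        iInf_le_of_le x (iInf_le_of_le (Subtype.ext h) le_rfl)
    have hm : Mono m := (mono_iff_injective m).mpr Subtype.val_injective
    exact ⟨⟨I, e, m, rfl, he, hm⟩⟩

end SetD

end SetDMono

/-! ### The lifting of `T` -/

section LiftingT

variable {Lang : FirstOrder.Language.{v, w}} [Lang.IsAlgebraic] {D : Type u} [Lang.Structure D]
  (T : Type u ⥤ Type u)

/-- The inclusion of the component at the largest subalgebra `D`. -/
noncomputable def liftTι (X : SetD Lang D) :
    ((functorV Lang D).obj (op ⊤)).obj (T.obj (((functorC Lang D).obj ⊤).obj X)) ⟶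
      (liftT Lang D T).obj X :=
  coend.ι ((diagramT Lang D T).obj X) ⊤

lemma liftTι_naturality {X Y : SetD Lang D} (f : X ⟶ Y) :
    liftTι T X ≫ (liftT Lang D T).map f =
      ((functorV Lang D).obj (op ⊤)).map (T.map (((functorC Lang D).obj ⊤).map f)) ≫
        liftTι T Y :=
  coend.ι_map ((diagramT Lang D T).map f) ⊤

/-- The underlying set of `T' X` is `T X`: as the subalgebra `D` is the largest one, the underlying
maps of the coend inclusions factor through the one at `D`. -/
lemma liftTι_bijective (X : SetD Lang D) : Function.Bijective (liftTι T X).toFun := by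
  constructor
  -- the underlying maps of the cowedge `T C^S X ⟶ T X`, with the least valuation on `T X`
  · let incl (S : Lang.Substructure D) : ((functorC Lang D).obj S).obj X ⟶ X.carrier :=
      TypeCat.ofHom Subtype.val
    let c (S : Lang.Substructure D) : (((diagramT Lang D T).obj X).obj (op S)).obj S ⟶
        (⟨T.obj X.carrier, fun _ => ⊥⟩ : SetD Lang D) :=
      ⟨fun z => T.map (incl S) z, fun _ => bot_le⟩
    have hc : ∀ ⦃S S' : Lang.Substructure D⦄ (h : S ⟶ S'),
        (((diagramT Lang D T).obj X).map h.op).app S ≫ c S =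
          (((diagramT Lang D T).obj X).obj (op S')).map h ≫ c S' := fun S S' h =>
      SetD.hom_ext fun z => ConcreteCategory.congr_hom
        (T.map_comp (((functorC Lang D).map h).app X) (incl S')) z
    have hcι : liftTι T X ≫ coend.desc c hc = c ⊤ := coend.ι_desc c hc ⊤
    have : Function.Injective (c ⊤).toFun := by
      let r : X.carrier ⟶ ((functorC Lang D).obj ⊤).obj X := TypeCat.ofHom fun x => ⟨x, le_top⟩
      have e : T.map (incl ⊤) ≫ T.map r = 𝟙 _ := by
        rw [← T.map_comp]
        exact T.map_id _
      exact Function.LeftInverse.injective (g := fun z => T.map r z)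
        fun z => ConcreteCategory.congr_hom e z
    rw [← hcι] at this
    exact Function.Injective.of_comp this
  · have : Epi (liftTι T X) := ⟨fun {Z} a b e => coend.hom_ext fun S => SetD.hom_ext fun z => by
      have h1 := congrArg SetD.Hom.toFun
        (coend.condition ((diagramT Lang D T).obj X) (homOfLE (le_top : S ≤ ⊤)))
      have h2 := congrFun h1 z
      refine (congrArg a.toFun h2).trans (Eq.trans ?_ (congrArg b.toFun h2).symm)
      exact congrFun (congrArg SetD.Hom.toFun e) _⟩
    exact SetD.surjective_of_epi _

lemma mono_liftT_map [T.PreservesMonomorphisms] {X Y : SetD Lang D} (f : X ⟶ Y) [Mono f] :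
    Mono ((liftT Lang D T).map f) := by
  have hf := (SetD.mono_iff_injective f).mp inferInstance
  have hC : Mono (((functorC Lang D).obj ⊤).map f) := (CategoryTheory.mono_iff_injective _).mpr
    fun x y h => Subtype.ext (hf (congrArg Subtype.val h))
  have hT := (CategoryTheory.mono_iff_injective _).mp
    (inferInstance : Mono (T.map (((functorC Lang D).obj ⊤).map f)))
  refine (SetD.mono_iff_injective _).mpr fun x y hxy => ?_
  obtain ⟨x, rfl⟩ := (liftTι_bijective T X).2 x
  obtain ⟨y, rfl⟩ := (liftTι_bijective T X).2 y
  have h := congrArg SetD.Hom.toFun (liftTι_naturality T f)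
  exact congrArg _ (hT ((liftTι_bijective T Y).1
    ((congrFun h x).symm.trans (hxy.trans (congrFun h y)))))

end LiftingT

/-! ### The adjoint transpose of the lifting of `δ` -/

section Transpose

variable {Lang : FirstOrder.Language.{v, w}} [Lang.IsAlgebraic] {D : Type u} [Lang.Structure D]
  [Fintype D] [Nontrivial D] [Lattice D] [BoundedOrder D] [BoundedLatticeReduct Lang D]
  [IsSemiPrimal Lang D] {T : Type u ⥤ Type u} (Λ : AbstractCoalgebraicLogic adjClassical.{u} T)

/-- The subset of `T Y` which `δ` assigns to an element of `L (P Y)`. -/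
def semantics {Y : Type u} (l : Λ.L.obj (functorPow.obj (op Y))) : Set (T.obj Y) :=
  Λ.δ.app (op Y) l

lemma mem_semantics_map_iff {Y Z : Type u} (f : Y ⟶ Z) (l : Λ.L.obj (functorPow.obj (op Z)))
    (t : T.obj Y) :
    t ∈ semantics Λ (Λ.L.map (functorPow.map f.op) l) ↔ T.map f t ∈ semantics Λ l := by
  have h : semantics Λ (Λ.L.map (functorPow.map f.op) l) = T.map f ⁻¹' semantics Λ l :=
    ConcreteCategory.congr_hom (Λ.δ.naturality f.op) l
  rw [h]
  rfl

lemma transpose_mem_iff (B : BoolAlg.{u}) (t : T.obj (UltrafilterBA B)) (l : Λ.L.obj B) :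
    UltrafilterBA.mem (Λ.transpose B t) l ↔
      t ∈ semantics Λ (Y := UltrafilterBA B) (Λ.L.map (adjClassical.unit.app B) l) := Iff.rfl

/-- Homomorphisms into `D` as ultrafilters of the Boolean skeleton. -/
noncomputable def pointsToUltrafilters (A : Variety Lang D) :
    ((functorC Lang D).obj ⊤).obj (homObj A) ⟶ UltrafilterBA (Skel A) :=
  TypeCat.ofHom fun u => ultrafilterOfHom (show A.carrier →[Lang] D from u.1)

lemma pointsToUltrafilters_injective (A : Variety Lang D) :
    Function.Injective (pointsToUltrafilters A) := fun u u' h => by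
  refine Subtype.ext (hom_ext_skel fun a => ?_)
  exact iff_of_eq (congrFun (congrArg UltrafilterBA.mem h) a)

lemma skelToK_comp_psiInv (A : Variety Lang D) :
    (skelToK ⊤ A ≫ ((functorK Lang D).obj (op ⊤)).map (evalAlg A)) ≫ psiInv ⊤ (homObj A) =
      adjClassical.unit.app ((skeleton Lang D).obj A) ≫
        functorPow.map (pointsToUltrafilters A).op := rfl

lemma lift_transpose_apply (A : Variety Lang D) (z : ((liftT Lang D T).obj (homObj A)).carrier)
    (x : ((liftL Lang D Λ.L).obj A).carrier) :
    DFunLike.coe (F := ((liftL Lang D Λ.L).obj A).carrier →[Lang] D)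
      (((Λ.lift Lang D).transpose A).toFun z) x =
      ((((liftδApp Λ (homObj A)).hom (((liftL Lang D Λ.L).map (evalAlg A)).hom x)) :
        ProdCarrier _) z : D) := rfl

lemma lift_transpose_ι_apply (A : Variety Lang D)
    (t : T.obj (((functorC Lang D).obj ⊤).obj (homObj A)))
    (x : ((liftL Lang D Λ.L).obj A).carrier) :
    DFunLike.coe (F := ((liftL Lang D Λ.L).obj A).carrier →[Lang] D)
      (((Λ.lift Lang D).transpose A).toFun ((liftTι T (homObj A)).toFun t)) x =
      ((wedge Λ (homObj A) ⊤).hom (((liftL Lang D Λ.L).map (evalAlg A)).hom x) : ProdCarrier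
        (((functorV Lang D).obj (op ⊤)).obj (T.obj (((functorC Lang D).obj ⊤).obj (homObj A))))) t := by
  rw [lift_transpose_apply, ← liftδApp_comp]
  rfl

/-- On the Boolean elements of `L' A`, the adjoint transpose of the lifting of `δ` is the adjoint
transpose of `δ`. -/
lemma lift_transpose_ofBool (A : Variety Lang D)
    (t : T.obj (((functorC Lang D).obj ⊤).obj (homObj A)))
    (l : Λ.L.obj ((skeleton Lang D).obj A)) :
    DFunLike.coe (F := ((liftL Lang D Λ.L).obj A).carrier →[Lang] D)
      (((Λ.lift Lang D).transpose A).toFun ((liftTι T (homObj A)).toFun t))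
      ((comparisonApp Λ.L A).hom (BoolPower.ofBool ⊥ l)) = ⊤ ↔
    UltrafilterBA.mem (Λ.transpose ((skeleton Lang D).obj A)
      (T.map (pointsToUltrafilters A) t)) l := by
  have e1 := liftL_map_comp_π Λ.L (evalAlg A) ⊤
  have e2 := comparisonApp_comp_π Λ.L A ⊤
  have e3 : (comparisonApp Λ.L A ≫ (liftL Lang D Λ.L).map (evalAlg A)) ≫ liftLπ Λ.L _ ⊤ =
      comparisonComponent Λ.L A ⊤ ≫ ((functorP Lang D).obj ⊤).map
        (Λ.L.map (((functorK Lang D).obj (op ⊤)).map (evalAlg A))) := by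
    rw [Category.assoc, e1, ← Category.assoc, e2]
  have e4 : BoolPower.val ((liftLπ Λ.L _ ⊤).hom (((liftL Lang D Λ.L).map (evalAlg A)).hom
      ((comparisonApp Λ.L A).hom (BoolPower.ofBool ⊥ l)))) ⊤ =
      Λ.L.map (((functorK Lang D).obj (op ⊤)).map (evalAlg A)) (Λ.L.map (skelToK ⊤ A) l) := by
    refine (congrArg (fun f => BoolPower.val (Variety.Hom.hom f (BoolPower.ofBool ⊥ l)) ⊤)
      e3).trans ?_
    exact congrArg (fun b => Λ.L.map (((functorK Lang D).obj (op ⊤)).map (evalAlg A))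
      (Λ.L.map (skelToK ⊤ A) b)) (BoolPower.ofBool_val_top (⊥ : Lang.Substructure D) l)
  rw [lift_transpose_ι_apply]
  refine Iff.trans ?_ (transpose_mem_iff Λ _ _ l).symm
  refine (BoolPower.value_eq_iff _ t ⊤).trans ?_
  refine Iff.trans ?_ (mem_semantics_map_iff Λ (pointsToUltrafilters A) _ t)
  have e5 (p : ((functorK Lang D).obj (op ⊤)).obj (prodObj (homObj A)) ⟶ functorPow.obj (op _))
      (hp : (skelToK ⊤ A ≫ ((functorK Lang D).obj (op ⊤)).map (evalAlg A)) ≫ p =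
        adjClassical.unit.app ((skeleton Lang D).obj A) ≫
          functorPow.map (pointsToUltrafilters A).op) :
      (Λ.L.map (skelToK ⊤ A) ≫ Λ.L.map (((functorK Lang D).obj (op ⊤)).map (evalAlg A))) ≫
        Λ.L.map p = Λ.L.map (adjClassical.unit.app ((skeleton Lang D).obj A)) ≫
          Λ.L.map (functorPow.map (pointsToUltrafilters A).op) := by
    rw [← Functor.map_comp, ← Functor.map_comp, hp, Functor.map_comp]
  refine iff_of_eq (congrArg (fun b => t ∈ semantics Λ b) ?_)
  exact (congrArg (Λ.L.map (psiInv ⊤ (homObj A))) e4).trans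
    (ConcreteCategory.congr_hom (e5 _ (skelToK_comp_psiInv A)) l)

/-- The components of the adjoint transpose of the lifting of `δ` are injective if those of the
adjoint transpose of `δ` are. -/
lemma mono_lift_transpose [T.PreservesMonomorphisms] (A : Variety Lang D)
    (h : Mono (Λ.transpose ((skeleton Lang D).obj A))) : Mono ((Λ.lift Lang D).transpose A) := by
  refine (SetD.mono_iff_injective _).mpr fun z z' hz => ?_
  obtain ⟨t, rfl⟩ := (liftTι_bijective T (homObj A)).2 z
  obtain ⟨t', rfl⟩ := (liftTι_bijective T (homObj A)).2 z'
  have hp : Mono (pointsToUltrafilters A) :=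
    (CategoryTheory.mono_iff_injective _).mpr (pointsToUltrafilters_injective A)
  refine congrArg _ ((CategoryTheory.mono_iff_injective _).mp
    (inferInstance : Mono (T.map (pointsToUltrafilters A)))
    ((CategoryTheory.mono_iff_injective _).mp h ?_))
  refine UltrafilterBA.ext (funext fun l => propext ?_)
  refine (lift_transpose_ofBool Λ A t l).symm.trans (Iff.trans ?_ (lift_transpose_ofBool Λ A t' l))
  rw [hz]

end Transpose

end MVLogic

theorem theorem4p7
    (Lang : FirstOrder.Language.{v, w}) [Lang.IsAlgebraic]
    (D : Type u) [Lang.Structure D] [Fintype D] [Nontrivial D]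
    [Lattice D] [BoundedOrder D] [MVLogic.BoundedLatticeReduct Lang D]
    [MVLogic.IsSemiPrimal Lang D]
    (T : Type u ⥤ Type u) [T.PreservesMonomorphisms] [T.PreservesEpimorphisms]
    (Λ : MVLogic.AbstractCoalgebraicLogic MVLogic.adjClassical.{u} T)
    [Λ.L.PreservesMonomorphisms] [Λ.L.PreservesEpimorphisms]
    (E M : MorphismProperty (Type u)) (hΛ : Λ.IsExpressive E M) :
    (Λ.lift Lang D).IsExpressive
      (MVLogic.strongEpimorphisms (MVLogic.SetD Lang D))
      (MorphismProperty.monomorphisms (MVLogic.SetD Lang D)) where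
  hasInitial :=
    have := hΛ.hasInitial
    MVLogic.hasInitial_algebra_liftL Λ.L
  epi _ _ _ h := h.epi
  mono := le_rfl
  hasFactorization := MVLogic.SetD.hasFactorization
  preserves _ _ f hf :=
    have : Mono f := hf
    MVLogic.mono_liftT_map T f
  transpose_mem A := MVLogic.mono_lift_transpose Λ A (hΛ.mono _ (hΛ.transpose_mem _))
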